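/- Let $N\in\mathbb N$ and let $B:[0,\infty)\to[0,\infty)$ be an N-function, i.e. continuous and convex, with $B(t)>0$ for $t>0$, $B(t)/t\to0$ as $t\to0^+$ and $B(t)/t\to\infty$ as $t\to\infty$. Let $\widetilde B(t)=\sup_{s\ge0}(st-B(s))$ be its complementary function, and let $b$ be the right derivative of $B$, i.e. the nondecreasing right-continuous function with $B(t)=\int_0^t b$. Assume that $B$ and $\widetilde B$ satisfy the $\Delta_2$ condition: there are $\alpha>0$, $t_0\ge0$ with $B(2t)\le\alpha B(t)$ for all $t\ge t_0$, and likewise for $\widetilde B$ (with its own constants). Let $\Omega\subset\mathbb R^N$ be a bounded open set, $Y=Z=(-\tfrac12,\tfrac12)^N$, and let $f:\mathbb R^N\times\mathbb R^N\times\mathbb R^N\to[0,\infty)$ satisfy: - $(H_1)$ for all $\lambda$, $f(\cdot,z,\lambda)$ is Lebesgue measurable for all $z$, and $f(y,\cdot,\lambda)$ is continuous for a.e. $y$; - $(H_2)$ $f(y,z,\cdot)$ is strictly convex for a.e. $y$ and all $z$; - $(H_3)$ for all $k,k'\in\mathbb Z^N$ and all $z,\lambda$: $f(y+k,z+k',\lambda)=f(y,z,\lambda)$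 for a.e. $y$; - $(H_4)$ there are $c_1,c_2>0$ with $c_1B(|\lambda|)\le f(y,z,\lambda)\le c_2(1+B(|\lambda|))$ for all $\lambda$, a.e. $y$ and all $z$. For a measure space $(X,\mu)$ and an N-function $A$, $L^A(X)$ is the set of measurable $u$ with $\int_X A(\delta|u|)\,d\mu\to0$ as $\delta\to0^+$, and $\|u\|_{A,X}=\inf\{k>0:\int_X A(|u|/k)\,d\mu\le1\}$. Let $\mathcal C(\overline\Omega;\mathcal C_{per}(Y\times Z))$ be the space of continuous maps from $\overline\Omega$ to the continuous $\mathbb Z^N\times\mathbb Z^N$-periodic functions on $\mathbb R^N\times\mathbb R^N$ (sup norm). For $A=B$ or $A(t)=t$ (written $L^1$), let $L^A_{per}(\Omega\times Y\times Z)$ be the space of measurable functions $u$ on $\Omega\times\mathbb R^N\times\mathbb R^N$ such that, for a.e. $x\in\Omega$, $u(x,\cdot,\cdot)$ is $\mathbb Z^N\times\mathbb Z^N$-periodic (a.e.), and $\iiint_{\Omega\times Y\times Z}A(|u|)\,dx\,dy\,dz<\infty$; functions are identified when they agree a.e. $L^B_{per}(\Omega\times Y\times Z)^N$ has the norm $\|v\|=\sum_{i=1}^N\|v^i\|_{B,\Omega\times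 Y\times Z}$, and $L^1_{per}(\Omega\times Y\times Z)$ the norm of $L^1(\Omega\times Y\times Z)$. **(i)** For every $v\in\mathcal C(\overline\Omega;\mathcal C_{per}(Y\times Z))^N$ the integrals below are those of integrable functions (for every $\varepsilon>0$), and $$\lim_{\varepsilon\to0^+}\int_\Omega f\Big(\frac x\varepsilon,\frac x{\varepsilon^2},v\Big(x,\frac x\varepsilon,\frac x{\varepsilon^2}\Big)\Big)dx=\iiint_{\Omega\times Y\times Z}f(y,z,v(x,y,z))\,dx\,dy\,dz .$$ **(ii)** $\mathcal C(\overline\Omega;\mathcal C_{per}(Y\times Z))^N\subset L^B_{per}(\Omega\times Y\times Z)^N$, and the mapping $v\mapsto f(\cdot,\cdot,v)$, $(x,y,z)\mapsto f(y,z,v(x,y,z))$, from $\mathcal C(\overline\Omega;\mathcal C_{per}(Y\times Z))^N$ to $L^1_{per}(\Omega\times Y\times Z)$ extends in exactly one way to a continuous mapping from $L^B_{per}(\Omega\times Y\times Z)^N$ to $L^1_{per}(\Omega\times Y\times Z)$; this extension is given by the same formula $v\mapsto f(\cdot,\cdot,v)$. **(iii)** There is a constant $c>0$ such that for all $v,w\in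 L^B_{per}(\Omega\times Y\times Z)^N$ one has $b(1+|v|+|w|)\in L^{\widetilde B}(\Omega\times Y\times Z)$ and $$\|f(\cdot,\cdot,v)-f(\cdot,\cdot,w)\|_{L^1(\Omega\times Y\times Z)}\le c\Big(\|1\|_{\widetilde B,\Omega}+\|b(1+|v|+|w|)\|_{\widetilde B,\Omega\times Y\times Z}\Big)\|v-w\|_{L^B_{per}(\Omega\times Y\times Z)^N}.$$ -/

import Mathlib

open MeasureTheory Set Filter Topology

namespace Reiterated

/-- The Euclidean space `ℝ^N`. -/
abbrev E (N : ℕ) : Type := EuclideanSpace ℝ (Fin N)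

/-- An N-function, as a real function of which only the values on `[0, ∞)` are used. -/
structure IsNFunction (B : ℝ → ℝ) : Prop where
  continuousOn : ContinuousOn B (Ici 0)
  convexOn : ConvexOn ℝ (Ici 0) B
  pos : ∀ t, 0 < t → 0 < B t
  tendsto_zero : Tendsto (fun t => B t / t) (𝓝[>] 0) (𝓝 0)
  tendsto_top : Tendsto (fun t => B t / t) atTop atTop

/-- The complementary function `t ↦ sup_{s ≥ 0} (s t - B s)`. -/
noncomputable def conj (B : ℝ → ℝ) (t : ℝ) : ℝ :=
  sSup ((fun s => s * t - B s) '' Ici 0)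

/-- The `Δ₂` condition (near infinity). -/
def IsDelta2 (B : ℝ → ℝ) : Prop :=
  ∃ α > 0, ∃ t₀ ≥ 0, ∀ t, t₀ ≤ t → B (2 * t) ≤ α * B t

/-- The right derivative of `B`. For an N-function `B` this is, on `[0, ∞)`, the unique
nondecreasing right continuous function `b` such that `B t = ∫₀ᵗ b`. -/
noncomputable def density (B : ℝ → ℝ) (t : ℝ) : ℝ :=
  derivWithin B (Ioi t) t

/-- A right continuous function `b` with `B t = ∫₀ᵗ b` on `[0, ∞)` is `density B` there. -/
theorem density_eq_of_integral {B b : ℝ → ℝ}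
    (hint : ∀ t, 0 ≤ t → IntervalIntegrable b volume 0 t)
    (hB : ∀ t, 0 ≤ t → B t = ∫ s in (0 : ℝ)..t, b s)
    (hb : ∀ t, 0 ≤ t → ContinuousWithinAt b (Ioi t) t)
    {t : ℝ} (ht : 0 ≤ t) : density B t = b t := by
  have hmeas : StronglyMeasurableAtFilter b (𝓝[>] t) volume := by
    refine ⟨Ioc t (t + 1), Ioc_mem_nhdsGT (by linarith), ?_⟩
    have h := (hint (t + 1) (by linarith)).1.aestronglyMeasurable
    exact h.mono_measure (Measure.restrict_mono (Ioc_subset_Ioc_left ht) le_rfl)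
  have h : HasDerivWithinAt (fun u => ∫ s in (0 : ℝ)..u, b s) (b t) (Ici t) t :=
    intervalIntegral.integral_hasDerivWithinAt_right (hint t ht) hmeas (hb t ht)
  have h2 : HasDerivWithinAt B (b t) (Ioi t) t :=
    (h.mono Ioi_subset_Ici_self).congr (fun s hs => hB s (ht.trans (le_of_lt hs))) (hB t ht)
  exact h2.derivWithin (uniqueDiffWithinAt_Ioi t)

/-- `u` belongs to the Orlicz space `L^A(μ)`. -/
def MemOrlicz {α : Type*} [MeasurableSpace α] (A : ℝ → ℝ) (μ : Measure α) (u : α → ℝ) : Prop :=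
  AEStronglyMeasurable u μ ∧
    Tendsto (fun δ : ℝ => ∫⁻ p, ENNReal.ofReal (A (δ * |u p|)) ∂μ) (𝓝[>] 0) (𝓝 0)

/-- The Luxemburg norm of `u` in `L^A(μ)`. -/
noncomputable def luxNorm {α : Type*} [MeasurableSpace α] (A : ℝ → ℝ) (μ : Measure α)
    (u : α → ℝ) : ℝ :=
  sInf {k : ℝ | 0 < k ∧ ∫⁻ p, ENNReal.ofReal (A (|u p| / k)) ∂μ ≤ 1}

/-- The open unit cube `]-1/2, 1/2[^N`. -/
def cube (N : ℕ) : Set (E N) := {y | ∀ i, y i ∈ Ioo (-(1 / 2) : ℝ) (1 / 2)}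

/-- The point of the lattice `ℤ^N ⊆ ℝ^N` with the given coordinates. -/
noncomputable def lat {N : ℕ} (k : Fin N → ℤ) : E N := WithLp.toLp 2 (fun i => (k i : ℝ))

/-- Lebesgue measure on `Ω × Y × Z`, where `Y = Z` is the unit cube. -/
noncomputable def cellMeasure {N : ℕ} (Ω : Set (E N)) : Measure (E N × E N × E N) :=
  volume.restrict (Ω ×ˢ (cube N ×ˢ cube N))

/-- `v ∈ C(closure Ω; C_per(Y × Z))^N`: a jointly continuous function on `closure Ω × ℝ^N × ℝ^N`
which is periodic in the last two variables. (For periodic functions and compact `closure Ω`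
joint continuity is the same as continuity of `x ↦ v (x, ·, ·)` for the sup norm.)
The values of `v` outside `closure Ω × ℝ^N × ℝ^N` play no role. -/
def IsContPer {N : ℕ} (Ω : Set (E N)) (v : E N × E N × E N → E N) : Prop :=
  ContinuousOn v (closure Ω ×ˢ univ) ∧
    ∀ x ∈ closure Ω, ∀ (k h : Fin N → ℤ) (y z : E N), v (x, y + lat k, z + lat h) = v (x, y, z)

/-- Measurable functions on `Ω × ℝ^N × ℝ^N` which for almost every `x` are periodic in `(y, z)`
and for which `∭_{Ω × Y × Z} A(|u|)` is finite. (Local integrability of `A(|u|)` on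
`Ω × ℝ^N × ℝ^N` follows from this by periodicity.) For a `Δ₂` N-function `A` and bounded `Ω`
this is `L^A_per(Ω × Y × Z)`. -/
structure MemPer {N : ℕ} (A : ℝ → ℝ) (Ω : Set (E N)) (u : E N × E N × E N → ℝ) : Prop where
  aestronglyMeasurable : AEStronglyMeasurable u (volume.restrict (Ω ×ˢ univ))
  periodic : ∀ᵐ x ∂(volume.restrict Ω), ∀ k h : Fin N → ℤ, ∀ᵐ q : E N × E N,
    u (x, q.1 + lat k, q.2 + lat h) = u (x, q.1, q.2)
  modular_lt_top : ∫⁻ p, ENNReal.ofReal (A |u p|) ∂(cellMeasure Ω) < ⊤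

/-- `L^1_per(Ω × Y × Z)`. -/
def MemL1Per {N : ℕ} (Ω : Set (E N)) (u : E N × E N × E N → ℝ) : Prop :=
  MemPer (fun t => t) Ω u

/-- `L^B_per(Ω × Y × Z)^N`, componentwise. -/
def MemLBPer {N : ℕ} (B : ℝ → ℝ) (Ω : Set (E N)) (v : E N × E N × E N → E N) : Prop :=
  ∀ i, MemPer B Ω (fun p => v p i)

/-- The norm of `L^B_per(Ω × Y × Z)^N`: the sum of the Luxemburg norms of the components. -/
noncomputable def normLBPer {N : ℕ} (B : ℝ → ℝ) (Ω : Set (E N))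
    (v : E N × E N × E N → E N) : ℝ :=
  ∑ i, luxNorm B (cellMeasure Ω) (fun p => v p i)

/-- The norm of `L^1(Ω × Y × Z)`. -/
noncomputable def normL1 {N : ℕ} (Ω : Set (E N)) (u : E N × E N × E N → ℝ) : ℝ :=
  ∫ p, |u p| ∂(cellMeasure Ω)

/-- The standing hypotheses on the integrand `f`. Measurability is with respect to the Lebesgue
σ-algebra. -/
structure IsIntegrand {N : ℕ} (B : ℝ → ℝ) (f : E N → E N → E N → ℝ) : Prop where
  nonneg : ∀ y z ξ, 0 ≤ f y z ξ
  measurable : ∀ ξ z, AEMeasurable (fun y => f y z ξ) volume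
  continuous : ∀ ξ, ∀ᵐ y : E N, Continuous (fun z => f y z ξ)
  strictConvex : ∀ᵐ y : E N, ∀ z, StrictConvexOn ℝ univ (f y z)
  periodic : ∀ (k k' : Fin N → ℤ) (z ξ : E N),
    ∀ᵐ y : E N, f (y + lat k) (z + lat k') ξ = f y z ξ
  growth : ∃ c₁ > 0, ∃ c₂ > 0, ∀ ξ, ∀ᵐ y : E N, ∀ z,
    c₁ * B ‖ξ‖ ≤ f y z ξ ∧ f y z ξ ≤ c₂ * (1 + B ‖ξ‖)

/-- The function `f(·, ·, v) : (x, y, z) ↦ f(y, z, v(x, y, z))`. -/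
def superpos {N : ℕ} (f : E N → E N → E N → ℝ) (v : E N × E N × E N → E N) :
    E N × E N × E N → ℝ :=
  fun p => f p.2.1 p.2.2 (v p)

/-- `Φ` (given on representatives) is a continuous map from `L^B_per(Ω × Y × Z)^N` to
`L^1_per(Ω × Y × Z)` which extends the map `v ↦ f(·, ·, v)` defined on
`C(closure Ω; C_per(Y × Z))^N`. -/
structure IsContExtension {N : ℕ} (B : ℝ → ℝ) (Ω : Set (E N)) (f : E N → E N → E N → ℝ)
    (Φ : (E N × E N × E N → E N) → (E N × E N × E N → ℝ)) : Prop where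
  mapsTo : ∀ v, MemLBPer B Ω v → MemL1Per Ω (Φ v)
  continuous : ∀ v, MemLBPer B Ω v → ∀ η > 0, ∃ δ > 0, ∀ w, MemLBPer B Ω w →
    normLBPer B Ω (w - v) < δ → normL1 Ω (Φ w - Φ v) < η
  extends_superpos : ∀ v, IsContPer Ω v → Φ v =ᵐ[cellMeasure Ω] superpos f v

end Reiterated

/-!
The superposition `v ↦ f(·, ·, v)` is controlled through a single pointwise estimate. Since
`f(y, z, ·)` is convex and grows at most like `1 + B(|·|)`, prolonging the segment from `ξ` to `η`
by the length `r = 1 + |ξ| + |η|` bounds its difference quotient by `(1 + B(2r))/r`, which the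
`Δ₂` condition turns into a multiple of `b(r)`
(`abs_convex_sub_le`, `exists_growth_div_le_density`). Hölder's inequality for the Luxemburg norms
(`lintegral_mul_le_luxNorm`) gives the Lipschitz estimate (`IsIntegrand.exists_normL1_sub_le`). The
norm of `b(1 + |v| + |w|)` is finite, and bounded for `w` near `v`, because the complementary
function at `b(t)` is at most `t b(t) - B(t) ≤ B(2t)`; hence the superposition is continuous on
`L^B_per`. Truncation and `L¹`-approximation by continuous functions on the torus show that
continuous periodic functions are dense (`exists_isContPer_normLBPer_lt`), so that the continuous
extension is unique (`IsContExtension.ae_eq`).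

The pointwise estimate also makes `f(y, ·, ·)` jointly continuous for almost every `y`, so that the
null sets in the hypotheses, which depend on the other variables, can be united into one
(`IsIntegrand.exists_ae_regular`).

For the oscillating integrals, let first `G(x, y, z)` be continuous and periodic in `(y, z)`. By the
Stone–Weierstrass theorem it may be taken of the form `φ(x) e_k(y) e_l(z)` with characters `e_k`,
`e_l` of the torus; then the integral of `G(x, x/ε, x/ε²)` is a Fourier coefficient of `φ 1_Ω` at a
frequency `k/ε + l/ε²` that tends to infinity unless `k = l = 0`, and the Riemann–Lebesgue lemma
applies (`tendsto_integral_oscPoint`). In general `f(y, z, v(x, y, z))` is only measurable in `y`,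
but it is a bounded measurable periodic function of `y` with values in the separable Banach space of
continuous functions of `(x, z)` (`IsIntegrand.exists_slice`). It is therefore approximated in
`L¹(Y; C)` by continuous periodic functions, and the error made after the substitution `y = x/ε` is
controlled uniformly in `ε ≤ 1` by counting cells (`exists_setLIntegral_inv_smul_le`).
-/

namespace Reiterated

/-! ### N-functions -/

namespace IsNFunction

variable {B : ℝ → ℝ}

lemma map_zero (hB : IsNFunction B) : B 0 = 0 := by
  have h1 : Tendsto B (𝓝[>] 0) (𝓝 (B 0)) :=
    ((hB.continuousOn 0 self_mem_Ici).mono Ioi_subset_Ici_self)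
  have h2 : Tendsto (fun t => B t / t * t) (𝓝[>] 0) (𝓝 (0 * 0)) :=
    hB.tendsto_zero.mul (tendsto_id.mono_left nhdsWithin_le_nhds)
  have h3 : Tendsto B (𝓝[>] 0) (𝓝 (0 * 0)) := by
    refine h2.congr' ?_
    filter_upwards [self_mem_nhdsWithin] with t ht
    exact div_mul_cancel₀ _ (ne_of_gt ht)
  simpa using tendsto_nhds_unique h1 h3

lemma nonneg (hB : IsNFunction B) {t : ℝ} (ht : 0 ≤ t) : 0 ≤ B t := by
  rcases ht.eq_or_lt with rfl | h
  · rw [hB.map_zero]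
  · exact (hB.pos t h).le

lemma map_mul_le (hB : IsNFunction B) {θ t : ℝ} (hθ : 0 ≤ θ) (hθ1 : θ ≤ 1) (ht : 0 ≤ t) :
    B (θ * t) ≤ θ * B t := by
  have h := hB.convexOn.2 (mem_Ici.2 ht) (mem_Ici.2 le_rfl) hθ (sub_nonneg.2 hθ1) (by ring)
  simpa [hB.map_zero] using h

lemma mono (hB : IsNFunction B) {s t : ℝ} (hs : 0 ≤ s) (hst : s ≤ t) : B s ≤ B t := by
  rcases hs.eq_or_lt with rfl | hs0
  · rw [hB.map_zero]; exact hB.nonneg hst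
  have ht : 0 < t := hs0.trans_le hst
  have h1 : s / t ≤ 1 := (div_le_one ht).2 hst
  have h := hB.map_mul_le (div_nonneg hs ht.le) h1 ht.le
  rw [div_mul_cancel₀ _ ht.ne'] at h
  exact h.trans (mul_le_of_le_one_left (hB.nonneg ht.le) h1)

lemma add_le (hB : IsNFunction B) {s t : ℝ} (hs : 0 ≤ s) (ht : 0 ≤ t) :
    B (s + t) ≤ B (2 * s) + B (2 * t) := by
  rcases le_total s t with h | h
  · linarith [hB.mono (add_nonneg hs ht) (show s + t ≤ 2 * t by linarith),
      hB.nonneg (show 0 ≤ 2 * s by linarith)]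
  · linarith [hB.mono (add_nonneg hs ht) (show s + t ≤ 2 * s by linarith),
      hB.nonneg (show 0 ≤ 2 * t by linarith)]

lemma continuous_comp_norm (hB : IsNFunction B) {E : Type*} [SeminormedAddCommGroup E] :
    Continuous fun ξ : E => B ‖ξ‖ :=
  hB.continuousOn.comp_continuous continuous_norm fun ξ => norm_nonneg ξ

/-- The `Δ₂` condition, made global at the price of an additive constant. -/
lemma exists_map_two_mul_le (hB : IsNFunction B) (h2 : IsDelta2 B) :
    ∃ α > 0, ∃ M ≥ 0, ∀ t, 0 ≤ t → B (2 * t) ≤ α * B t + M := by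
  obtain ⟨α, hα, t₀, ht₀, h⟩ := h2
  refine ⟨α, hα, B (2 * t₀), hB.nonneg (by linarith), fun t ht => ?_⟩
  rcases le_total t₀ t with h' | h'
  · linarith [h t h', hB.nonneg (show 0 ≤ 2 * t₀ by linarith)]
  · have := hB.mono (show 0 ≤ 2 * t by linarith) (show 2 * t ≤ 2 * t₀ by linarith)
    linarith [mul_nonneg hα.le (hB.nonneg ht)]

lemma bddAbove_conj (hB : IsNFunction B) (t : ℝ) :
    BddAbove ((fun s => s * t - B s) '' Ici 0) := by
  -- beyond some `R` one has `B s ≥ t * s`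
  obtain ⟨R, hR⟩ := (hB.tendsto_top.eventually_ge_atTop t).exists_forall_of_atTop
  refine ⟨max 0 (|R| * |t|), ?_⟩
  rintro _ ⟨s, hs, rfl⟩
  have hs0 : (0 : ℝ) ≤ s := hs
  rcases le_total R s with h | h
  · refine le_max_of_le_left ?_
    rcases hs0.eq_or_lt with rfl | hpos
    · simp [hB.map_zero]
    · have := (le_div_iff₀ hpos).1 (hR s h)
      simp only; linarith
  · refine le_max_of_le_right ?_
    have h1 : s * t ≤ |R| * |t| :=
      (le_abs_self _).trans (by
        rw [abs_mul, abs_of_nonneg hs0]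
        exact mul_le_mul_of_nonneg_right (h.trans (le_abs_self R)) (abs_nonneg t))
    simp only; linarith [hB.nonneg hs0]

/-- Young's inequality. -/
lemma mul_le_add_conj (hB : IsNFunction B) {s : ℝ} (hs : 0 ≤ s) (t : ℝ) :
    s * t ≤ B s + conj B t := by
  have : s * t - B s ≤ conj B t := le_csSup (hB.bddAbove_conj t) ⟨s, hs, rfl⟩
  linarith

lemma conj_le {t M : ℝ} (h : ∀ s, 0 ≤ s → s * t - B s ≤ M) : conj B t ≤ M := by
  refine csSup_le (nonempty_Ici.image _) ?_
  rintro _ ⟨s, hs, rfl⟩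
  exact h s hs

lemma conj_nonneg (hB : IsNFunction B) (t : ℝ) : 0 ≤ conj B t := by
  simpa [hB.map_zero] using hB.mul_le_add_conj le_rfl t

lemma conj_mul_le (hB : IsNFunction B) {θ t : ℝ} (hθ : 0 ≤ θ) (hθ1 : θ ≤ 1) :
    conj B (θ * t) ≤ θ * conj B t := by
  refine conj_le fun s hs => ?_
  have h1 := mul_le_mul_of_nonneg_left (hB.mul_le_add_conj hs t) hθ
  have h2 : θ * B s ≤ B s := mul_le_of_le_one_left (hB.nonneg hs) hθ1
  linarith

/-- The graph of `B` lies above its right tangents. -/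
lemma tangent_le (hB : IsNFunction B) {t s : ℝ} (ht : 0 < t) (hs : 0 ≤ s) :
    B t + density B t * (s - t) ≤ B s := by
  have hti : t ∈ interior (Ici (0 : ℝ)) := by simpa using ht
  rcases lt_trichotomy s t with h | rfl | h
  · have h1 := hB.convexOn.slope_le_leftDeriv_of_mem_interior (mem_Ici.2 hs) hti h
    have h2 := h1.trans (hB.convexOn.leftDeriv_le_rightDeriv_of_mem_interior hti)
    rw [slope_def_field, div_le_iff₀ (sub_pos.2 h)] at h2
    change B t - B s ≤ density B t * (t - s) at h2
    linarith
  · simp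
  · have h1 := hB.convexOn.rightDeriv_le_slope_of_mem_interior hti (mem_Ici.2 hs) h
    rw [slope_def_field, le_div_iff₀ (sub_pos.2 h)] at h1
    change density B t * (s - t) ≤ B s - B t at h1
    linarith

lemma le_mul_density (hB : IsNFunction B) {t : ℝ} (ht : 0 < t) : B t ≤ t * density B t := by
  have := hB.tangent_le ht le_rfl
  rw [hB.map_zero] at this
  linarith

lemma density_pos (hB : IsNFunction B) {t : ℝ} (ht : 0 < t) : 0 < density B t :=
  pos_of_mul_pos_right ((hB.pos t ht).trans_le (hB.le_mul_density ht)) ht.le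

lemma monotoneOn_density (hB : IsNFunction B) : MonotoneOn (density B) (Ioi 0) := by
  have h := hB.convexOn.monotoneOn_rightDeriv
  rwa [interior_Ici] at h

/-- The equality case of Young's inequality bounds the conjugate along the density. -/
lemma conj_density_le (hB : IsNFunction B) {t : ℝ} (ht : 0 < t) :
    conj B (density B t) ≤ B (2 * t) := by
  have h2 := hB.tangent_le ht (show 0 ≤ 2 * t by linarith)
  refine conj_le fun s hs => ?_
  have h1 := hB.tangent_le ht hs
  linarith [hB.nonneg ht.le]

end IsNFunction

/-! ### The Luxemburg norm -/

section Luxemburg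

variable {α : Type*} [MeasurableSpace α] {μ : Measure α} {A : ℝ → ℝ} {u : α → ℝ}

lemma luxNorm_nonneg : 0 ≤ luxNorm A μ u :=
  Real.sInf_nonneg fun _ hk => hk.1.le

lemma luxNorm_le {k : ℝ} (hk : 0 < k)
    (h : ∫⁻ p, ENNReal.ofReal (A (|u p| / k)) ∂μ ≤ 1) : luxNorm A μ u ≤ k :=
  csInf_le ⟨0, fun _ hk => hk.1.le⟩ ⟨hk, h⟩

/-- A modular which contracts in this sense (such as that of an N-function or of a complementary
function) is at most one at the scale `1 + ∫ A(|u|)`. -/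
lemma modular_div_le_one (hA : ∀ θ t, 0 ≤ θ → θ ≤ 1 → 0 ≤ t → A (θ * t) ≤ θ * A t)
    (hu : ∫⁻ p, ENNReal.ofReal (A |u p|) ∂μ ≠ ⊤) :
    ∫⁻ p, ENNReal.ofReal
      (A (|u p| / (1 + (∫⁻ p, ENNReal.ofReal (A |u p|) ∂μ).toReal))) ∂μ ≤ 1 := by
  set I := ∫⁻ p, ENNReal.ofReal (A |u p|) ∂μ with hI
  have hI0 : 0 ≤ I.toReal := ENNReal.toReal_nonneg
  set k := 1 + I.toReal with hk
  have hk0 : 0 < k := by positivity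
  have hk1 : k⁻¹ ≤ 1 := inv_le_one_of_one_le₀ (by linarith)
  calc ∫⁻ p, ENNReal.ofReal (A (|u p| / k)) ∂μ
      ≤ ∫⁻ p, ENNReal.ofReal k⁻¹ * ENNReal.ofReal (A |u p|) ∂μ := by
        refine lintegral_mono fun p => ?_
        rw [← ENNReal.ofReal_mul (by positivity), div_eq_inv_mul]
        exact ENNReal.ofReal_le_ofReal (hA _ _ (by positivity) hk1 (abs_nonneg _))
    _ = ENNReal.ofReal k⁻¹ * I := lintegral_const_mul' _ _ ENNReal.ofReal_ne_top
    _ = ENNReal.ofReal (k⁻¹ * I.toReal) := by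
        rw [ENNReal.ofReal_mul (by positivity), ENNReal.ofReal_toReal hu]
    _ ≤ 1 := by
        rw [← ENNReal.ofReal_one]
        refine ENNReal.ofReal_le_ofReal ?_
        rw [inv_mul_le_iff₀ hk0]
        linarith

lemma luxNorm_le_one_add (hA : ∀ θ t, 0 ≤ θ → θ ≤ 1 → 0 ≤ t → A (θ * t) ≤ θ * A t)
    (hu : ∫⁻ p, ENNReal.ofReal (A |u p|) ∂μ ≠ ⊤) :
    luxNorm A μ u ≤ 1 + (∫⁻ p, ENNReal.ofReal (A |u p|) ∂μ).toReal :=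
  luxNorm_le (by positivity) (modular_div_le_one hA hu)

/-- The finiteness of the modular excludes the junk value `sInf ∅ = 0` of the norm. -/
lemma exists_modular_le_one_of_luxNorm_lt
    (hA : ∀ θ t, 0 ≤ θ → θ ≤ 1 → 0 ≤ t → A (θ * t) ≤ θ * A t)
    (hu : ∫⁻ p, ENNReal.ofReal (A |u p|) ∂μ ≠ ⊤) {r : ℝ} (hr : luxNorm A μ u < r) :
    ∃ k, 0 < k ∧ k < r ∧ ∫⁻ p, ENNReal.ofReal (A (|u p| / k)) ∂μ ≤ 1 := by
  have hne : {k : ℝ | 0 < k ∧ ∫⁻ p, ENNReal.ofReal (A (|u p| / k)) ∂μ ≤ 1}.Nonempty :=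
    ⟨_, by positivity, modular_div_le_one hA hu⟩
  obtain ⟨k, hk, hkr⟩ := exists_lt_of_csInf_lt hne hr
  exact ⟨k, hk.1, hkr, hk.2⟩

/-- Hölder's inequality for the Luxemburg norms of complementary functions. -/
lemma lintegral_mul_le_luxNorm {B : ℝ → ℝ} (hB : IsNFunction B) {g : α → ℝ}
    (hum : AEMeasurable u μ) (hu : ∫⁻ p, ENNReal.ofReal (B |u p|) ∂μ ≠ ⊤)
    (hg : ∫⁻ p, ENNReal.ofReal (conj B |g p|) ∂μ ≠ ⊤) :
    ∫⁻ p, ENNReal.ofReal (|u p| * |g p|) ∂μ ≤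
      ENNReal.ofReal (2 * luxNorm B μ u * luxNorm (conj B) μ g) := by
  set a := luxNorm B μ u with ha
  set b := luxNorm (conj B) μ g with hb
  have ha0 : 0 ≤ a := luxNorm_nonneg
  have hb0 : 0 ≤ b := luxNorm_nonneg
  have key : ∀ d : ℝ, 0 < d → ∫⁻ p, ENNReal.ofReal (|u p| * |g p|) ∂μ ≤
      ENNReal.ofReal (2 * (a + d) * (b + d)) := by
    intro d hd
    obtain ⟨k, hk, hka, hkI⟩ := exists_modular_le_one_of_luxNorm_lt (r := a + d)
      (fun θ t h0 h1 ht => hB.map_mul_le h0 h1 ht) hu (by linarith)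
    obtain ⟨l, hl, hlb, hlI⟩ := exists_modular_le_one_of_luxNorm_lt (r := b + d)
      (fun θ t h0 h1 _ => hB.conj_mul_le h0 h1) hg (by linarith)
    have hm : AEMeasurable (fun p => ENNReal.ofReal (B (|u p| / k))) μ := by
      have hc : Continuous fun s : ℝ => B (|s| / k) := by
        have : Continuous fun s : ℝ => B ‖s / k‖ :=
          hB.continuous_comp_norm.comp (continuous_id.div_const k)
        simpa [abs_div, abs_of_pos hk] using this
      exact (hc.measurable.comp_aemeasurable hum).ennreal_ofReal
    calc ∫⁻ p, ENNReal.ofReal (|u p| * |g p|) ∂μ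
        ≤ ∫⁻ p, ENNReal.ofReal (k * l) *
            (ENNReal.ofReal (B (|u p| / k)) + ENNReal.ofReal (conj B (|g p| / l))) ∂μ := by
          refine lintegral_mono fun p => ?_
          have h1 : 0 ≤ |u p| / k := by positivity
          rw [← ENNReal.ofReal_add (hB.nonneg h1) (hB.conj_nonneg _),
            ← ENNReal.ofReal_mul (by positivity)]
          refine ENNReal.ofReal_le_ofReal ?_
          have h2 := mul_le_mul_of_nonneg_left (hB.mul_le_add_conj h1 (|g p| / l))
            (mul_pos hk hl).le
          refine le_trans (le_of_eq ?_) h2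
          field_simp
      _ = ENNReal.ofReal (k * l) * (∫⁻ p, ENNReal.ofReal (B (|u p| / k)) ∂μ +
            ∫⁻ p, ENNReal.ofReal (conj B (|g p| / l)) ∂μ) := by
          rw [lintegral_const_mul' _ _ ENNReal.ofReal_ne_top, lintegral_add_left' hm]
      _ ≤ ENNReal.ofReal (k * l) * (1 + 1) := by gcongr
      _ = ENNReal.ofReal (2 * k * l) := by
          rw [one_add_one_eq_two, ← ENNReal.ofReal_ofNat 2, ← ENNReal.ofReal_mul (by positivity)]
          congr 1; ring
      _ ≤ ENNReal.ofReal (2 * (a + d) * (b + d)) := by gcongr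
  have hlim : Tendsto (fun d : ℝ => ENNReal.ofReal (2 * (a + d) * (b + d))) (𝓝[>] 0)
      (𝓝 (ENNReal.ofReal (2 * (a + 0) * (b + 0)))) := by
    refine (ENNReal.continuous_ofReal.comp ?_).continuousAt.tendsto.mono_left nhdsWithin_le_nhds
    fun_prop
  rw [add_zero, add_zero] at hlim
  refine ge_of_tendsto hlim ?_
  filter_upwards [self_mem_nhdsWithin] with d hd using key d hd

end Luxemburg

/-! ### Convex functions of Orlicz growth -/

section Convex

variable {V : Type*} [NormedAddCommGroup V] [NormedSpace ℝ V] {B : ℝ → ℝ} {c : ℝ} {g : V → ℝ}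

/-- The difference quotient over a segment is at most the one over its prolongation, where the growth
bound applies. -/
lemma convex_sub_le (hB : IsNFunction B) (hc : 0 < c) (hg : ConvexOn ℝ univ g)
    (h0 : ∀ ξ, 0 ≤ g ξ) (h1 : ∀ ξ, g ξ ≤ c * (1 + B ‖ξ‖)) (ξ η : V) :
    g η - g ξ ≤ c * (1 + B (2 * (1 + ‖ξ‖ + ‖η‖))) / (1 + ‖ξ‖ + ‖η‖) * ‖η - ξ‖ := by
  set r := 1 + ‖ξ‖ + ‖η‖ with hr
  have hr0 : 0 < r := by positivity
  set d := ‖η - ξ‖ with hd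
  rcases (norm_nonneg (η - ξ)).eq_or_lt with h | h
  · have : η = ξ := by rw [← sub_eq_zero, ← norm_eq_zero]; exact h.symm
    subst this
    simp [d]
  have hd0 : 0 < d := h
  -- `η` lies between `ξ` and a point `ζ` of norm at most `2 r` at distance `r` from `η`
  set ζ := η + (r / d) • (η - ξ) with hζ
  have hcomb : (r / (r + d)) • ξ + (d / (r + d)) • ζ = η := by
    rw [hζ, smul_add, smul_smul, smul_sub,
      show d / (r + d) * (r / d) = r / (r + d) by field_simp,
      show (r / (r + d)) • ξ + ((d / (r + d)) • η + ((r / (r + d)) • η - (r / (r + d)) • ξ))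
        = (d / (r + d)) • η + (r / (r + d)) • η by abel, ← add_smul,
      show d / (r + d) + r / (r + d) = 1 by field_simp; ring, one_smul]
  have hconv := hg.2 (mem_univ ξ) (mem_univ ζ) (show 0 ≤ r / (r + d) by positivity)
    (show 0 ≤ d / (r + d) by positivity) (by field_simp)
  rw [hcomb, smul_eq_mul, smul_eq_mul] at hconv
  have hζn : ‖ζ‖ ≤ 2 * r := by
    have h2 : ‖(r / d) • (η - ξ)‖ = r := by
      rw [norm_smul, Real.norm_of_nonneg (by positivity), ← hd]; field_simp
    calc ‖ζ‖ ≤ ‖η‖ + r := (norm_add_le _ _).trans_eq (by rw [h2])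
      _ ≤ 2 * r := by linarith [norm_nonneg ξ]
  have hgζ : g ζ ≤ c * (1 + B (2 * r)) := (h1 ζ).trans <| by
    gcongr
    exact hB.mono (norm_nonneg _) hζn
  have hA : r / (r + d) * g ξ ≤ g ξ :=
    mul_le_of_le_one_left (h0 ξ) ((div_le_one (by positivity)).2 (by linarith))
  have hC : d / (r + d) * g ζ ≤ d / r * (c * (1 + B (2 * r))) :=
    mul_le_mul (by gcongr; linarith) hgζ (h0 ζ) (by positivity)
  calc g η - g ξ ≤ d / r * (c * (1 + B (2 * r))) := by linarith
    _ = _ := by ring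

lemma abs_convex_sub_le (hB : IsNFunction B) (hc : 0 < c) (hg : ConvexOn ℝ univ g)
    (h0 : ∀ ξ, 0 ≤ g ξ) (h1 : ∀ ξ, g ξ ≤ c * (1 + B ‖ξ‖)) (ξ η : V) :
    |g ξ - g η| ≤ c * (1 + B (2 * (1 + ‖ξ‖ + ‖η‖))) / (1 + ‖ξ‖ + ‖η‖) * ‖ξ - η‖ := by
  refine abs_sub_le_iff.2 ⟨?_, ?_⟩
  · have := convex_sub_le hB hc hg h0 h1 η ξ
    rwa [add_right_comm] at this
  · have := convex_sub_le hB hc hg h0 h1 ξ η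
    rwa [norm_sub_rev] at this

/-- Under the `Δ₂` condition the difference quotients of `B` over `[r, 2 r]` are controlled by the
density at `r`, uniformly for `r ≥ 1`. -/
lemma exists_growth_div_le_density (hB : IsNFunction B) (h2 : IsDelta2 B) (hc : 0 < c) :
    ∃ C > 0, ∀ r, 1 ≤ r → c * (1 + B (2 * r)) / r ≤ C * density B r := by
  obtain ⟨α, hα, M, hM, h⟩ := hB.exists_map_two_mul_le h2
  have hb1 := hB.density_pos one_pos
  refine ⟨c * ((1 + M) / density B 1 + α), by positivity, fun r hr => ?_⟩
  have hr0 : 0 < r := by linarith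
  have hbr := hB.monotoneOn_density (mem_Ioi.2 one_pos) (mem_Ioi.2 hr0) hr
  have h3 := h r hr0.le
  have h4 := hB.le_mul_density hr0
  have h5 : (1 + M) ≤ (1 + M) / density B 1 * density B r * r := by
    have : 1 ≤ density B r / density B 1 := (one_le_div hb1).2 hbr
    calc 1 + M = (1 + M) * 1 * 1 := by ring
      _ ≤ (1 + M) * (density B r / density B 1) * r := by gcongr
      _ = _ := by ring
  rw [div_le_iff₀ hr0, mul_assoc, mul_assoc]
  refine mul_le_mul_of_nonneg_left ?_ hc.le
  nlinarith [mul_le_mul_of_nonneg_left h4 hα.le]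

end Convex

/-! ### Carathéodory functions -/

/-- A function that is measurable in one variable and, for almost every value of it, continuous in
the other one has a version with both properties everywhere. -/
lemma exists_caratheodory_version {α P : Type*} [MeasurableSpace α] {μ : Measure α}
    [TopologicalSpace P] [FirstCountableTopology P] [TopologicalSpace.SeparableSpace P] [Nonempty P]
    {h : α → P → ℝ} (hm : ∀ p, AEMeasurable (fun y => h y p) μ)
    (hc : ∀ᵐ y ∂μ, Continuous (h y)) :
    ∃ g : α → P → ℝ, (∀ p, Measurable fun y => g y p) ∧ (∀ y, Continuous (g y)) ∧
      ∀ᵐ y ∂μ, g y = h y := by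
  classical
  set D : ℕ → P := TopologicalSpace.denseSeq P
  have hae : ∀ᵐ y ∂μ, Continuous (h y) ∧ ∀ n, h y (D n) = (hm (D n)).mk _ y :=
    hc.and (ae_all_iff.2 fun n => (hm (D n)).ae_eq_mk)
  obtain ⟨S, hS, hSm, hS0⟩ := exists_measurable_superset_of_null (mem_ae_iff.1 hae)
  have hgood : ∀ y, y ∉ S → Continuous (h y) ∧ ∀ n, h y (D n) = (hm (D n)).mk _ y := fun y hy => by
    by_contra hcon
    exact hy (hS hcon)
  refine ⟨fun y p => if y ∈ S then 0 else h y p, fun p => ?_, fun y => ?_, ?_⟩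
  · obtain ⟨x, hx, hxp⟩ := mem_closure_iff_seq_limit.1
      ((TopologicalSpace.denseRange_denseSeq P).closure_range ▸ mem_univ p)
    refine measurable_of_tendsto_metrizable
      (f := fun n y => if y ∈ S then 0 else h y (x n)) (fun n => ?_) ?_
    · obtain ⟨m, hm'⟩ := hx n
      have : (fun y => if y ∈ S then 0 else h y (x n)) =
          fun y => if y ∈ S then 0 else (hm (D m)).mk _ y := by
        funext y
        split_ifs with hy
        · rfl
        · rw [← hm', (hgood y hy).2 m]
      simp only [this]
      exact Measurable.ite hSm measurable_const (hm (D m)).measurable_mk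
    · refine tendsto_pi_nhds.2 fun y => ?_
      by_cases hy : y ∈ S
      · simp only [hy, if_true]
        exact tendsto_const_nhds
      · simp only [hy, if_false]
        exact ((hgood y hy).1.tendsto p).comp hxp
  · dsimp only
    split_ifs with hy
    · exact continuous_const
    · exact (hgood y hy).1
  · filter_upwards [measure_eq_zero_iff_ae_notMem.1 hS0] with y hy
    simp [hy]

/-- Separate continuity on a dense set of parameters, together with local Lipschitz continuity in
the parameter, gives joint continuity. -/
lemma continuous_uncurry_of_lipschitz {V : Type*} [NormedAddCommGroup V]
    {Z : Type*} [TopologicalSpace Z] {φ : Z → V → ℝ} {D : Set V} (hD : Dense D)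
    (hφ : ∀ d ∈ D, Continuous fun z => φ z d) {L : ℝ → ℝ}
    (hL : ∀ R z ξ η, ‖ξ‖ ≤ R → ‖η‖ ≤ R → |φ z ξ - φ z η| ≤ L R * ‖ξ - η‖) :
    Continuous fun p : Z × V => φ p.1 p.2 := by
  refine continuous_iff_continuousAt.2 fun ⟨z₀, ξ₀⟩ => ?_
  refine continuousAt_of_locally_uniform_approx_of_continuousAt fun u hu => ?_
  obtain ⟨ε, hε, hεu⟩ := Metric.mem_uniformity_dist.1 hu
  set K := |L (‖ξ₀‖ + 1)| + 1 with hK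
  have hK0 : 0 < K := by positivity
  set δ := min 1 (ε / (2 * K)) with hδ
  have hδ0 : 0 < δ := by positivity
  obtain ⟨d, hdD, hd⟩ := hD.exists_dist_lt ξ₀ hδ0
  refine ⟨univ ×ˢ Metric.ball ξ₀ δ, prod_mem_nhds univ_mem (Metric.ball_mem_nhds _ hδ0),
    fun p => φ p.1 d, ((hφ d hdD).comp continuous_fst).continuousAt, ?_⟩
  rintro ⟨z, ξ⟩ ⟨-, hξ⟩
  refine hεu ?_
  rw [Real.dist_eq]
  have hξ' : ‖ξ - ξ₀‖ < δ := mem_ball_iff_norm.1 hξ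
  have hd' : ‖ξ₀ - d‖ < δ := by rwa [← dist_eq_norm]
  have h1 : ‖ξ‖ ≤ ‖ξ₀‖ + 1 := by
    have := norm_le_norm_add_norm_sub' ξ ξ₀
    linarith [min_le_left 1 (ε / (2 * K))]
  have h2 : ‖d‖ ≤ ‖ξ₀‖ + 1 := by
    have := norm_le_norm_add_norm_sub' d ξ₀
    rw [norm_sub_rev] at this
    linarith [min_le_left 1 (ε / (2 * K))]
  have h3 : ‖ξ - d‖ < 2 * δ := by
    have := norm_add_le (ξ - ξ₀) (ξ₀ - d)
    rw [sub_add_sub_cancel] at this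
    linarith
  calc |φ z ξ - φ z d| ≤ L (‖ξ₀‖ + 1) * ‖ξ - d‖ := hL _ z ξ d h1 h2
    _ ≤ K * ‖ξ - d‖ := by
        gcongr
        linarith [le_abs_self (L (‖ξ₀‖ + 1))]
    _ < K * (2 * δ) := by gcongr
    _ ≤ K * (2 * (ε / (2 * K))) := by gcongr; exact min_le_right _ _
    _ = ε := by field_simp

section Integrand

variable {N : ℕ} {B : ℝ → ℝ} {f : E N → E N → E N → ℝ}

lemma ae_forall_add_lat {p : E N → Prop} (h : ∀ᵐ y : E N, p y) :
    ∀ᵐ y : E N, ∀ k : Fin N → ℤ, p (y + lat k) :=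
  ae_all_iff.2 fun k => (measurePreserving_add_right volume (lat k)).quasiMeasurePreserving.ae h

/-- The hypotheses on the integrand, with all exceptional null sets united into a single one. -/
lemma IsIntegrand.exists_ae_regular (hB : IsNFunction B) (hf : IsIntegrand B f) :
    ∃ c > 0, ∀ᵐ y : E N, Continuous (fun p : E N × E N => f y p.1 p.2) ∧
      (∀ z, ConvexOn ℝ univ (f y z)) ∧ (∀ z ξ, f y z ξ ≤ c * (1 + B ‖ξ‖)) ∧
      ∀ (k k' : Fin N → ℤ) z ξ, f (y + lat k) (z + lat k') ξ = f y z ξ := by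
  obtain ⟨c₁, hc₁, c, hc, hgrowth⟩ := hf.growth
  refine ⟨c, hc, ?_⟩
  set D : Set (E N) := range (TopologicalSpace.denseSeq (E N))
  have hD : Dense D := TopologicalSpace.denseRange_denseSeq (E N)
  have hDc : D.Countable := countable_range _
  have hreg : ∀ᵐ y : E N, Continuous (fun p : E N × E N => f y p.1 p.2) ∧
      (∀ z, ConvexOn ℝ univ (f y z)) ∧ (∀ z ξ, f y z ξ ≤ c * (1 + B ‖ξ‖)) := by
    filter_upwards [hf.strictConvex, (ae_ball_iff hDc).2 fun ξ _ => hf.continuous ξ,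
      (ae_ball_iff hDc).2 fun ξ _ => hgrowth ξ] with y h1 h2 h3
    have hconv : ∀ z, ConvexOn ℝ univ (f y z) := fun z => (h1 z).convexOn
    have hgr : ∀ z ξ, f y z ξ ≤ c * (1 + B ‖ξ‖) := by
      intro z
      have hcl : IsClosed {ξ | f y z ξ ≤ c * (1 + B ‖ξ‖)} :=
        isClosed_le (continuousOn_univ.1 ((hconv z).continuousOn isOpen_univ))
          (continuous_const.mul (continuous_const.add hB.continuous_comp_norm))
      intro ξ
      have := hcl.closure_subset_iff.2 (fun d (hd : d ∈ D) => (h3 d hd z).2)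
      exact this (hD.closure_eq ▸ mem_univ ξ)
    refine ⟨continuous_uncurry_of_lipschitz hD h2
      (L := fun R => c * (1 + B (2 * (1 + R + R)))) ?_, hconv, hgr⟩
    intro R z ξ η hξ hη
    refine (abs_convex_sub_le hB hc (hconv z) (hf.nonneg y z) (hgr z) ξ η).trans ?_
    refine mul_le_mul_of_nonneg_right ?_ (norm_nonneg _)
    have h4 : B (2 * (1 + ‖ξ‖ + ‖η‖)) ≤ B (2 * (1 + R + R)) :=
      hB.mono (by positivity) (by linarith)
    have h5 : 0 ≤ B (2 * (1 + ‖ξ‖ + ‖η‖)) := hB.nonneg (by positivity)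
    calc _ ≤ c * (1 + B (2 * (1 + ‖ξ‖ + ‖η‖))) :=
          div_le_self (by positivity) (by linarith [norm_nonneg ξ, norm_nonneg η])
      _ ≤ _ := by gcongr
  have hper : ∀ᵐ y : E N, ∀ k k' : Fin N → ℤ, ∀ z ∈ D, ∀ ξ ∈ D,
      f (y + lat k) (z + lat k') ξ = f y z ξ :=
    ae_all_iff.2 fun k => ae_all_iff.2 fun k' => (ae_ball_iff hDc).2 fun z _ =>
      (ae_ball_iff hDc).2 fun ξ _ => hf.periodic k k' z ξ
  filter_upwards [hreg, ae_forall_add_lat hreg, hper] with y h1 h2 h3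
  refine ⟨h1.1, h1.2.1, h1.2.2, fun k k' z ξ => ?_⟩
  have hcl : IsClosed {p : E N × E N | f (y + lat k) (p.1 + lat k') p.2 = f y p.1 p.2} := by
    refine isClosed_eq ?_ h1.1
    exact (h2 k).1.comp (by fun_prop : Continuous fun p : E N × E N => (p.1 + lat k', p.2))
  have := hcl.closure_subset_iff.2 (fun d (hd : d ∈ D ×ˢ D) => h3 k k' d.1 hd.1 d.2 hd.2)
  have hz : (z, ξ) ∈ closure (D ×ˢ D) := (hD.prod hD).closure_eq ▸ mem_univ _
  exact this hz

/-- A jointly Borel version of the integrand, continuous in the last two variables. -/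
lemma IsIntegrand.exists_measurable_version (hB : IsNFunction B) (hf : IsIntegrand B f) :
    ∃ g : E N → E N × E N → ℝ, Measurable (fun p : E N × (E N × E N) => g p.1 p.2) ∧
      (∀ y, Continuous (g y)) ∧ ∀ᵐ y : E N, ∀ z ξ, g y (z, ξ) = f y z ξ := by
  obtain ⟨c, -, hreg⟩ := hf.exists_ae_regular hB
  obtain ⟨g, hgm, hgc, hg⟩ := exists_caratheodory_version
    (h := fun (y : E N) (p : E N × E N) => f y p.1 p.2) (μ := volume)
    (fun p => hf.measurable p.2 p.1) (hreg.mono fun y hy => hy.1)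
  refine ⟨g, ?_, hgc, hg.mono fun y hy z ξ => congrFun hy (z, ξ)⟩
  exact (measurable_uncurry_of_continuous_of_measurable (u := fun p y => g y p) hgc hgm).comp
    measurable_swap

end Integrand

/-! ### Finiteness of modulars -/

section Modular

variable {B : ℝ → ℝ}

lemma IsNFunction.exists_map_mul_le (hB : IsNFunction B) (h2 : IsDelta2 B) {K : ℝ} (hK : 0 ≤ K) :
    ∃ α ≥ 0, ∃ M ≥ 0, ∀ t, 0 ≤ t → B (K * t) ≤ α * B t + M := by
  obtain ⟨α, hα, M, hM, h⟩ := hB.exists_map_two_mul_le h2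
  have key : ∀ n : ℕ, ∃ α ≥ 0, ∃ M ≥ 0, ∀ t, 0 ≤ t → B (2 ^ n * t) ≤ α * B t + M := by
    intro n
    induction n with
    | zero => exact ⟨1, zero_le_one, 0, le_rfl, fun t _ => by simp⟩
    | succ n ih =>
      obtain ⟨α', hα', M', hM', h'⟩ := ih
      refine ⟨α * α', by positivity, α * M' + M, by positivity, fun t ht => ?_⟩
      have h3 := h (2 ^ n * t) (by positivity)
      have h4 := mul_le_mul_of_nonneg_left (h' t ht) hα.le
      rw [pow_succ', mul_assoc]
      linarith
  obtain ⟨n, hn⟩ := pow_unbounded_of_one_lt K one_lt_two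
  obtain ⟨α', hα', M', hM', h'⟩ := key n
  exact ⟨α', hα', M', hM', fun t ht => (hB.mono (by positivity) (by gcongr)).trans (h' t ht)⟩

lemma norm_le_sum_abs {N : ℕ} (ξ : E N) : ‖ξ‖ ≤ ∑ i, |ξ i| := by
  refine abs_le_of_sq_le_sq' ?_ (by positivity) |>.2
  rw [EuclideanSpace.norm_sq_eq]
  exact Finset.sum_sq_le_sq_sum_of_nonneg fun i _ => norm_nonneg _

/-- The modular of the Euclidean norm is controlled by those of the components. -/
lemma IsNFunction.exists_map_mul_norm_le (hB : IsNFunction B) (h2 : IsDelta2 B) (N : ℕ) {K : ℝ}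
    (hK : 0 ≤ K) :
    ∃ α ≥ 0, ∃ M ≥ 0, ∀ ξ : E N, B (K * ‖ξ‖) ≤ α * ∑ i, B |ξ i| + M := by
  obtain ⟨α, hα, M, hM, h⟩ := hB.exists_map_mul_le h2 (show 0 ≤ K * N by positivity)
  refine ⟨α, hα, M, hM, fun ξ => ?_⟩
  have hnn : ∀ i, 0 ≤ B |ξ i| := fun i => hB.nonneg (abs_nonneg _)
  rcases isEmpty_or_nonempty (Fin N) with he | hne
  · have : ‖ξ‖ = 0 := le_antisymm ((norm_le_sum_abs ξ).trans (by simp)) (norm_nonneg _)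
    simpa [this, hB.map_zero] using hM
  obtain ⟨i, -, hi⟩ := Finset.exists_max_image Finset.univ (fun i => |ξ i|) Finset.univ_nonempty
  have h3 : ‖ξ‖ ≤ N * |ξ i| := (norm_le_sum_abs ξ).trans <| by
    simpa using Finset.sum_le_card_nsmul Finset.univ (fun i => |ξ i|) _ hi
  calc B (K * ‖ξ‖) ≤ B (K * N * |ξ i|) :=
        hB.mono (by positivity) (by rw [mul_assoc]; gcongr)
    _ ≤ α * B |ξ i| + M := h _ (abs_nonneg _)
    _ ≤ α * ∑ i, B |ξ i| + M := by
        gcongr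
        exact Finset.single_le_sum (f := fun i => B |ξ i|) (fun i _ => hnn i) (Finset.mem_univ i)

variable {α : Type*} [MeasurableSpace α] {μ : Measure α}

lemma lintegral_ofReal_ne_top_of_le [IsFiniteMeasure μ] {F G : α → ℝ} {a M : ℝ} (ha : 0 ≤ a)
    (hG : ∫⁻ p, ENNReal.ofReal (G p) ∂μ ≠ ⊤) (h : ∀ᵐ p ∂μ, F p ≤ a * G p + M) :
    ∫⁻ p, ENNReal.ofReal (F p) ∂μ ≠ ⊤ := by
  refine ne_top_of_le_ne_top ?_ (lintegral_mono_ae (g := fun p =>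
    ENNReal.ofReal a * ENNReal.ofReal (G p) + ENNReal.ofReal M) ?_)
  · rw [lintegral_add_right _ measurable_const, lintegral_const_mul' _ _ ENNReal.ofReal_ne_top,
      lintegral_const]
    exact ENNReal.add_ne_top.2 ⟨ENNReal.mul_ne_top ENNReal.ofReal_ne_top hG,
      ENNReal.mul_ne_top ENNReal.ofReal_ne_top (measure_ne_top _ _)⟩
  · filter_upwards [h] with p hp
    rw [← ENNReal.ofReal_mul ha]
    exact (ENNReal.ofReal_le_ofReal hp).trans ENNReal.ofReal_add_le

lemma IsNFunction.aemeasurable_modular (hB : IsNFunction B) {V : Type*} [SeminormedAddCommGroup V]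
    [MeasurableSpace V] [OpensMeasurableSpace V] {u : α → V} (hu : AEMeasurable u μ) :
    AEMeasurable (fun p => ENNReal.ofReal (B ‖u p‖)) μ :=
  (hB.continuous_comp_norm.measurable.comp_aemeasurable hu).ennreal_ofReal

lemma IsNFunction.aemeasurable_modular_abs (hB : IsNFunction B) {u : α → ℝ}
    (hu : AEMeasurable u μ) : AEMeasurable (fun p => ENNReal.ofReal (B |u p|)) μ :=
  hB.aemeasurable_modular hu

lemma modular_sub_ne_top [IsFiniteMeasure μ] (hB : IsNFunction B) (h2 : IsDelta2 B) {u w : α → ℝ}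
    (hum : AEMeasurable u μ) (hu : ∫⁻ p, ENNReal.ofReal (B |u p|) ∂μ ≠ ⊤)
    (hw : ∫⁻ p, ENNReal.ofReal (B |w p|) ∂μ ≠ ⊤) {K : ℝ} (hK : 0 ≤ K) :
    ∫⁻ p, ENNReal.ofReal (B (K * |u p - w p|)) ∂μ ≠ ⊤ := by
  obtain ⟨a, ha, M, hM, h⟩ := hB.exists_map_mul_le h2 (show 0 ≤ 2 * K by positivity)
  have h3 : ∫⁻ p, ENNReal.ofReal (B |u p| + B |w p|) ∂μ ≠ ⊤ := by
    have : ∀ p, ENNReal.ofReal (B |u p| + B |w p|) =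
        ENNReal.ofReal (B |u p|) + ENNReal.ofReal (B |w p|) := fun p =>
      ENNReal.ofReal_add (hB.nonneg (abs_nonneg _)) (hB.nonneg (abs_nonneg _))
    simp only [this]
    rw [lintegral_add_left' (hB.aemeasurable_modular_abs hum)]
    exact ENNReal.add_ne_top.2 ⟨hu, hw⟩
  refine lintegral_ofReal_ne_top_of_le (M := 2 * M) ha h3 (ae_of_all _ fun p => ?_)
  have h4 : K * |u p - w p| ≤ K * |u p| + K * |w p| := by
    rw [← mul_add]; gcongr; exact abs_sub _ _
  have h5 := hB.add_le (show 0 ≤ K * |u p| by positivity) (show 0 ≤ K * |w p| by positivity)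
  have h6 := h |u p| (abs_nonneg _)
  have h7 := h |w p| (abs_nonneg _)
  rw [mul_assoc] at h6 h7
  linarith [hB.mono (by positivity) h4]

end Modular

/-! ### The measure on the cell -/

section Cell

variable {N : ℕ} {Ω : Set (E N)}

/-- The closed unit cube, as the image of an order interval of `Fin N → ℝ`. -/
lemma isCompact_closedCube :
    IsCompact {y : E N | ∀ i, y i ∈ Icc (-(1 / 2) : ℝ) (1 / 2)} := by
  have h := (isCompact_univ_pi fun _ : Fin N => isCompact_Icc (a := (-(1 / 2) : ℝ)) (b := 1 / 2))
    |>.image (PiLp.continuous_toLp 2 fun _ : Fin N => ℝ)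
  convert h using 1
  ext y
  constructor
  · intro hy
    exact ⟨WithLp.ofLp y, fun i _ => hy i, rfl⟩
  · rintro ⟨x, hx, rfl⟩ i
    exact hx i (mem_univ i)

lemma cube_subset : cube N ⊆ {y : E N | ∀ i, y i ∈ Icc (-(1 / 2) : ℝ) (1 / 2)} :=
  fun _ hy i => Ioo_subset_Icc_self (hy i)

lemma isOpen_cube : IsOpen (cube N) := by
  have : cube N = ⋂ i, (fun y : E N => y i) ⁻¹' Ioo (-(1 / 2) : ℝ) (1 / 2) := by
    ext y; simp [cube]
  rw [this]
  exact isOpen_iInter_of_finite fun i => isOpen_Ioo.preimage (by fun_prop)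

lemma volume_cube_lt_top : volume (cube N) < ⊤ :=
  (measure_mono cube_subset).trans_lt isCompact_closedCube.measure_lt_top

lemma cellMeasure_eq : cellMeasure Ω = (volume.restrict Ω).prod
    ((volume.restrict (cube N)).prod (volume.restrict (cube N))) := by
  rw [Measure.prod_restrict, Measure.prod_restrict]
  rfl

lemma isFiniteMeasure_cellMeasure (hΩb : Bornology.IsBounded Ω) :
    IsFiniteMeasure (cellMeasure Ω) := by
  have h1 : IsFiniteMeasure (volume.restrict Ω) := ⟨by simpa using hΩb.measure_lt_top⟩
  have h2 : IsFiniteMeasure (volume.restrict (cube N)) := ⟨by simpa using volume_cube_lt_top⟩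
  rw [cellMeasure_eq]
  infer_instance

lemma cellMeasure_le : cellMeasure Ω ≤ volume.restrict (Ω ×ˢ univ) :=
  Measure.restrict_mono (prod_mono_right (subset_univ _)) le_rfl

lemma ae_snd_fst {p : E N → Prop} (h : ∀ᵐ y, p y) : ∀ᵐ q : E N × E N × E N, p q.2.1 :=
  (Measure.quasiMeasurePreserving_fst.comp Measure.quasiMeasurePreserving_snd).ae h

lemma MemPer.aemeasurable {A : ℝ → ℝ} {u : E N × E N × E N → ℝ} (hu : MemPer A Ω u) :
    AEMeasurable u (cellMeasure Ω) :=
  hu.aestronglyMeasurable.aemeasurable.mono_measure cellMeasure_le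

lemma aemeasurable_of_components {α : Type*} [MeasurableSpace α] {μ : Measure α} {v : α → E N}
    (h : ∀ i, AEMeasurable (fun p => v p i) μ) : AEMeasurable v μ :=
  (WithLp.measurable_toLp 2 _).comp_aemeasurable (aemeasurable_pi_lambda (fun p i => v p i) h)

lemma MemLBPer.aemeasurable {B : ℝ → ℝ} {v : E N × E N × E N → E N} (hv : MemLBPer B Ω v) :
    AEMeasurable v (cellMeasure Ω) :=
  aemeasurable_of_components fun i => (hv i).aemeasurable

lemma MemLBPer.modular_norm_ne_top {B : ℝ → ℝ} (hB : IsNFunction B) (h2 : IsDelta2 B)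
    (hΩb : Bornology.IsBounded Ω) {v : E N × E N × E N → E N} (hv : MemLBPer B Ω v) {K : ℝ}
    (hK : 0 ≤ K) : ∫⁻ p, ENNReal.ofReal (B (K * ‖v p‖)) ∂(cellMeasure Ω) ≠ ⊤ := by
  have := isFiniteMeasure_cellMeasure hΩb
  obtain ⟨a, ha, M, hM, h⟩ := hB.exists_map_mul_norm_le h2 N hK
  refine lintegral_ofReal_ne_top_of_le ha ?_ (ae_of_all _ fun p => h (v p))
  simp only [ENNReal.ofReal_sum_of_nonneg fun i _ => hB.nonneg (abs_nonneg _)]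
  rw [lintegral_finsetSum' _ fun i _ => hB.aemeasurable_modular_abs (hv i).aemeasurable]
  exact ENNReal.sum_ne_top.2 fun i _ => (hv i).modular_lt_top.ne

end Cell

/-! ### The superposition operator -/

section Superposition

variable {N : ℕ} {B : ℝ → ℝ} {Ω : Set (E N)} {f : E N → E N → E N → ℝ}
  {v w : E N × E N × E N → E N}

/-- The superposition with the integrand is measurable although the integrand itself is only
Lebesgue measurable in `y`. -/
lemma IsIntegrand.aestronglyMeasurable_superpos (hB : IsNFunction B) (hf : IsIntegrand B f)
    {S : Set (E N × E N × E N)} (hv : AEMeasurable v (volume.restrict S)) :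
    AEStronglyMeasurable (superpos f v) (volume.restrict S) := by
  obtain ⟨g, hgm, -, hg⟩ := hf.exists_measurable_version hB
  have h : AEMeasurable (fun p : E N × E N × E N => (p.2.1, p.2.2, v p)) (volume.restrict S) :=
    (measurable_fst.comp measurable_snd).aemeasurable.prodMk
      ((measurable_snd.comp measurable_snd).aemeasurable.prodMk hv)
  refine (hgm.comp_aemeasurable h).aestronglyMeasurable.congr ?_
  filter_upwards [ae_restrict_of_ae (ae_snd_fst hg)] with p hp
  exact hp _ _

lemma IsIntegrand.memL1Per_superpos (hB : IsNFunction B) (h2 : IsDelta2 B)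
    (hΩb : Bornology.IsBounded Ω) (hf : IsIntegrand B f) (hv : MemLBPer B Ω v) :
    MemL1Per Ω (superpos f v) := by
  obtain ⟨c, hc, hreg⟩ := hf.exists_ae_regular hB
  refine ⟨?_, ?_, ?_⟩
  · exact hf.aestronglyMeasurable_superpos hB
      (aemeasurable_of_components fun i => (hv i).aestronglyMeasurable.aemeasurable)
  · have hper := ae_all_iff.2 fun i => (hv i).periodic
    filter_upwards [hper] with x hx k h
    have h1 : ∀ᵐ q : E N × E N, ∀ i, v (x, q.1 + lat k, q.2 + lat h) i = v (x, q.1, q.2) i :=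
      ae_all_iff.2 fun i => hx i k h
    filter_upwards [h1, Measure.quasiMeasurePreserving_fst.ae hreg] with q hq hr
    have : v (x, q.1 + lat k, q.2 + lat h) = v (x, q.1, q.2) := by
      ext i; exact hq i
    simp only [superpos, this]
    exact hr.2.2.2 k h _ _
  · have := isFiniteMeasure_cellMeasure hΩb
    refine (lintegral_ofReal_ne_top_of_le hc.le (M := c)
      (hv.modular_norm_ne_top hB h2 hΩb zero_le_one) ?_).lt_top
    filter_upwards [ae_restrict_of_ae (ae_snd_fst hreg)] with p hp
    simp only [superpos, abs_of_nonneg (hf.nonneg _ _ _)]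
    have := hp.2.2.1 p.2.2 (v p)
    rw [one_mul]
    linarith

lemma MemL1Per.integrable {u : E N × E N × E N → ℝ} (hu : MemL1Per Ω u) :
    Integrable u (cellMeasure Ω) := by
  refine ⟨hu.aestronglyMeasurable.mono_measure cellMeasure_le, ?_⟩
  rw [hasFiniteIntegral_iff_norm]
  exact hu.modular_lt_top

/-- The pointwise local Lipschitz estimate for the integrand. -/
lemma IsIntegrand.exists_abs_sub_le (hB : IsNFunction B) (h2 : IsDelta2 B)
    (hf : IsIntegrand B f) : ∃ C > 0, ∀ᵐ y : E N, ∀ z ξ η,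
      |f y z ξ - f y z η| ≤ C * density B (1 + ‖ξ‖ + ‖η‖) * ‖ξ - η‖ := by
  obtain ⟨c, hc, hreg⟩ := hf.exists_ae_regular hB
  obtain ⟨C, hC, h⟩ := exists_growth_div_le_density hB h2 hc
  refine ⟨C, hC, ?_⟩
  filter_upwards [hreg] with y hy z ξ η
  refine (abs_convex_sub_le hB hc (hy.2.1 z) (hf.nonneg y z) (hy.2.2.1 z) ξ η).trans ?_
  gcongr
  exact h _ (by linarith [norm_nonneg ξ, norm_nonneg η])

lemma IsNFunction.aemeasurable_density (hB : IsNFunction B) {α : Type*} [MeasurableSpace α]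
    {μ : Measure α} {v w : α → E N} (hv : AEMeasurable v μ) (hw : AEMeasurable w μ) :
    AEMeasurable (fun p => density B (1 + ‖v p‖ + ‖w p‖)) μ := by
  -- the density is monotone only on `(0, ∞)`, so it is first frozen below `1`
  have hmono : Monotone fun t => density B (max t 1) := fun s t hst =>
    hB.monotoneOn_density (mem_Ioi.2 (by positivity)) (mem_Ioi.2 (by positivity))
      (max_le_max_right 1 hst)
  have h : AEMeasurable (fun p => 1 + ‖v p‖ + ‖w p‖) μ := (hv.norm.const_add 1).add hw.norm
  refine (hmono.measurable.comp_aemeasurable h).congr (ae_of_all _ fun p => ?_)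
  simp only [Function.comp]
  rw [max_eq_left (by linarith [norm_nonneg (v p), norm_nonneg (w p)])]

lemma IsNFunction.conj_density_norm_le (hB : IsNFunction B) (ξ η : E N) :
    conj B |density B (1 + ‖ξ‖ + ‖η‖)| ≤ B (2 * (1 + ‖ξ‖ + ‖η‖)) := by
  have hr : 0 < 1 + ‖ξ‖ + ‖η‖ := by positivity
  rw [abs_of_pos (hB.density_pos hr)]
  exact hB.conj_density_le hr

lemma IsNFunction.map_two_mul_one_add_le (hB : IsNFunction B) {s t : ℝ} (hs : 0 ≤ s)
    (ht : 0 ≤ t) : B (2 * (1 + s + t)) ≤ B 4 + (B (8 * s) + B (8 * t)) := by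
  have h1 := hB.add_le (show (0 : ℝ) ≤ 2 by norm_num) (show 0 ≤ 2 * s + 2 * t by positivity)
  have h3 := hB.add_le (show (0 : ℝ) ≤ 4 * s by positivity) (show 0 ≤ 4 * t by positivity)
  ring_nf at h1 h3 ⊢
  linarith

/-- The density along `1 + |v| + |w|` has finite conjugate modular, since `conj B (b t)` is
dominated by `B (2 t)`. -/
lemma modular_density_ne_top (hB : IsNFunction B) (h2 : IsDelta2 B)
    (hΩb : Bornology.IsBounded Ω) (hv : MemLBPer B Ω v) (hw : MemLBPer B Ω w) :
    ∫⁻ p, ENNReal.ofReal (conj B |density B (1 + ‖v p‖ + ‖w p‖)|) ∂(cellMeasure Ω) ≠ ⊤ := by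
  have := isFiniteMeasure_cellMeasure hΩb
  have h3 : ∫⁻ p, ENNReal.ofReal (B (8 * ‖v p‖) + B (8 * ‖w p‖)) ∂(cellMeasure Ω) ≠ ⊤ := by
    refine ne_top_of_le_ne_top (ENNReal.add_ne_top.2
      ⟨hv.modular_norm_ne_top hB h2 hΩb (K := 8) (by norm_num),
        hw.modular_norm_ne_top hB h2 hΩb (K := 8) (by norm_num)⟩)
      (le_trans (lintegral_mono fun p => ENNReal.ofReal_add_le) ?_)
    rw [lintegral_add_left']
    have h := hB.aemeasurable_modular (hv.aemeasurable.const_smul (8 : ℝ))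
    simpa [norm_smul] using h
  refine lintegral_ofReal_ne_top_of_le (M := B 4) zero_le_one h3 (ae_of_all _ fun p => ?_)
  have h4 := hB.conj_density_norm_le (v p) (w p)
  have h5 := hB.map_two_mul_one_add_le (norm_nonneg (v p)) (norm_nonneg (w p))
  linarith

/-- The conjugate modular of the density along `1 + |w| + |v|` stays bounded while `w` varies in
a modular neighbourhood of `v`. -/
lemma exists_modular_density_le (hB : IsNFunction B) (h2 : IsDelta2 B)
    (hΩb : Bornology.IsBounded Ω) (hv : MemLBPer B Ω v) :
    ∃ K : ENNReal, K ≠ ⊤ ∧ ∀ w, MemLBPer B Ω w →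
      (∀ i, ∫⁻ p, ENNReal.ofReal (B |w p i - v p i|) ∂(cellMeasure Ω) ≤ 1) →
      ∫⁻ p, ENNReal.ofReal (conj B |density B (1 + ‖w p‖ + ‖v p‖)|) ∂(cellMeasure Ω) ≤ K := by
  have := isFiniteMeasure_cellMeasure hΩb
  obtain ⟨a, ha, M, hM, h⟩ := hB.exists_map_mul_norm_le h2 N (show (0 : ℝ) ≤ 16 by norm_num)
  set I := ∫⁻ p, ENNReal.ofReal (B (32 * ‖v p‖)) ∂(cellMeasure Ω) with hI
  set m := cellMeasure Ω univ with hm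
  refine ⟨ENNReal.ofReal (B 4 + M) * m + (I + ENNReal.ofReal a * N), ?_, fun w hw hd => ?_⟩
  · have h3 : I ≠ ⊤ := hv.modular_norm_ne_top hB h2 hΩb (by norm_num)
    have h4 : m ≠ ⊤ := measure_ne_top _ _
    finiteness
  have hpt : ∀ p, ENNReal.ofReal (conj B |density B (1 + ‖w p‖ + ‖v p‖)|) ≤
      ENNReal.ofReal (B 4 + M) + (ENNReal.ofReal (B (32 * ‖v p‖)) +
        ENNReal.ofReal a * ∑ i, ENNReal.ofReal (B |w p i - v p i|)) := by
    intro p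
    have hnn : 0 ≤ ∑ i, B |w p i - v p i| :=
      Finset.sum_nonneg fun i _ => hB.nonneg (abs_nonneg _)
    have hB4 : 0 ≤ B 4 := hB.nonneg (by norm_num)
    have hB32 : 0 ≤ B (32 * ‖v p‖) := hB.nonneg (by positivity)
    rw [← ENNReal.ofReal_sum_of_nonneg fun i _ => hB.nonneg (abs_nonneg _),
      ← ENNReal.ofReal_mul ha, ← ENNReal.ofReal_add hB32 (by positivity),
      ← ENNReal.ofReal_add (by positivity) (by positivity)]
    refine ENNReal.ofReal_le_ofReal ?_
    have h4 := hB.conj_density_norm_le (w p) (v p)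
    have h5 : B (2 * (1 + ‖w p‖ + ‖v p‖)) ≤ B (2 * (1 + (2 * ‖v p‖) + ‖w p - v p‖)) := by
      refine hB.mono (by positivity) ?_
      linarith [norm_le_norm_add_norm_sub' (w p) (v p)]
    have h6 := hB.map_two_mul_one_add_le (show 0 ≤ 2 * ‖v p‖ by positivity)
      (norm_nonneg (w p - v p))
    have h7 : B (8 * ‖w p - v p‖) ≤ B (16 * ‖w p - v p‖) :=
      hB.mono (by positivity) (by linarith [norm_nonneg (w p - v p)])
    have h8 := h (w p - v p)
    have h9 : B (8 * (2 * ‖v p‖)) ≤ B (32 * ‖v p‖) :=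
      hB.mono (by positivity) (by linarith [norm_nonneg (v p)])
    simp only [PiLp.sub_apply] at h8
    linarith
  have hmeas : ∀ i, AEMeasurable (fun p => ENNReal.ofReal (B |w p i - v p i|)) (cellMeasure Ω) :=
    fun i => hB.aemeasurable_modular_abs ((hw i).aemeasurable.sub (hv i).aemeasurable)
  refine (lintegral_mono hpt).trans ?_
  rw [lintegral_add_left measurable_const, lintegral_const]
  refine add_le_add le_rfl ?_
  rw [lintegral_add_left', lintegral_const_mul' _ _ ENNReal.ofReal_ne_top,
    lintegral_finsetSum' _ fun i _ => hmeas i]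
  · gcongr
    simpa using Finset.sum_le_sum fun i (_ : i ∈ Finset.univ) => hd i
  · have h := hB.aemeasurable_modular (hv.aemeasurable.const_smul (32 : ℝ))
    simpa [norm_smul] using h

lemma memOrlicz_density (hB : IsNFunction B) (h2 : IsDelta2 B)
    (hΩb : Bornology.IsBounded Ω) (hv : MemLBPer B Ω v) (hw : MemLBPer B Ω w) :
    MemOrlicz (conj B) (cellMeasure Ω) (fun p => density B (1 + ‖v p‖ + ‖w p‖)) := by
  refine ⟨(hB.aemeasurable_density hv.aemeasurable hw.aemeasurable).aestronglyMeasurable, ?_⟩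
  set b := fun p => density B (1 + ‖v p‖ + ‖w p‖) with hb
  set I := ∫⁻ p, ENNReal.ofReal (conj B |b p|) ∂(cellMeasure Ω) with hI
  have hI' : I ≠ ⊤ := modular_density_ne_top hB h2 hΩb hv hw
  have hlim : Tendsto (fun δ : ℝ => ENNReal.ofReal δ * I) (𝓝[>] 0) (𝓝 0) := by
    have h : Tendsto (fun δ : ℝ => ENNReal.ofReal δ) (𝓝[>] 0) (𝓝 0) := by
      have := (ENNReal.continuous_ofReal.tendsto 0).mono_left
        (nhdsWithin_le_nhds (s := Ioi (0 : ℝ)))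
      simpa using this
    simpa using ENNReal.Tendsto.mul_const h (Or.inr hI')
  refine tendsto_of_tendsto_of_tendsto_of_le_of_le' tendsto_const_nhds hlim
    (Eventually.of_forall fun _ => zero_le) ?_
  filter_upwards [Ioc_mem_nhdsGT (zero_lt_one (α := ℝ))] with δ hδ
  rw [hI, ← lintegral_const_mul' _ _ ENNReal.ofReal_ne_top]
  refine lintegral_mono fun p => ?_
  rw [← ENNReal.ofReal_mul hδ.1.le]
  exact ENNReal.ofReal_le_ofReal (hB.conj_mul_le hδ.1.le hδ.2)

/-- The Lipschitz estimate in norm: Hölder's inequality applied to the pointwise one. -/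
lemma IsIntegrand.exists_normL1_sub_le (hB : IsNFunction B) (h2 : IsDelta2 B)
    (hΩb : Bornology.IsBounded Ω) (hf : IsIntegrand B f) :
    ∃ c > 0, ∀ v w, MemLBPer B Ω v → MemLBPer B Ω w →
      normL1 Ω (superpos f v - superpos f w) ≤
        c * luxNorm (conj B) (cellMeasure Ω) (fun p => density B (1 + ‖v p‖ + ‖w p‖)) *
          normLBPer B Ω (v - w) := by
  have := isFiniteMeasure_cellMeasure hΩb
  obtain ⟨C, hC, hlip⟩ := hf.exists_abs_sub_le hB h2
  refine ⟨C * 2, by positivity, fun v w hv hw => ?_⟩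
  set b := fun p => density B (1 + ‖v p‖ + ‖w p‖) with hb
  have hbm : AEMeasurable b (cellMeasure Ω) :=
    hB.aemeasurable_density hv.aemeasurable hw.aemeasurable
  set L := luxNorm (conj B) (cellMeasure Ω) b with hL
  have hL0 : 0 ≤ L := luxNorm_nonneg
  have hn0 : 0 ≤ normLBPer B Ω (v - w) := Finset.sum_nonneg fun i _ => luxNorm_nonneg
  have hum : ∀ i, AEMeasurable (fun p => (v - w) p i) (cellMeasure Ω) := fun i =>
    (hv i).aemeasurable.sub (hw i).aemeasurable
  have hholder : ∀ i, ∫⁻ p, ENNReal.ofReal (|(v - w) p i| * |b p|) ∂(cellMeasure Ω) ≤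
      ENNReal.ofReal (2 * luxNorm B (cellMeasure Ω) (fun p => (v - w) p i) * L) := fun i => by
    refine lintegral_mul_le_luxNorm hB (hum i) ?_ (modular_density_ne_top hB h2 hΩb hv hw)
    simpa using modular_sub_ne_top hB h2 (hv i).aemeasurable (hv i).modular_lt_top.ne
      (hw i).modular_lt_top.ne zero_le_one
  have hpt : ∀ᵐ p ∂(cellMeasure Ω), ENNReal.ofReal ‖|(superpos f v - superpos f w) p|‖ ≤
      ENNReal.ofReal C * ∑ i, ENNReal.ofReal (|(v - w) p i| * |b p|) := by
    filter_upwards [ae_restrict_of_ae (ae_snd_fst hlip)] with p hp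
    rw [← ENNReal.ofReal_sum_of_nonneg fun i _ => by positivity, ← ENNReal.ofReal_mul hC.le,
      ← Finset.sum_mul]
    refine ENNReal.ofReal_le_ofReal ?_
    rw [norm_abs_eq_norm, Real.norm_eq_abs]
    have hb0 : 0 < b p := hB.density_pos (by positivity)
    have h3 := norm_le_sum_abs (v p - w p)
    rw [abs_of_pos hb0]
    calc |f p.2.1 p.2.2 (v p) - f p.2.1 p.2.2 (w p)| ≤ C * b p * ‖v p - w p‖ := hp _ _ _
      _ ≤ C * b p * ∑ i, |(v - w) p i| := by gcongr; exact h3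
      _ = _ := by ring
  have hle : ∫⁻ p, ENNReal.ofReal ‖|(superpos f v - superpos f w) p|‖ ∂(cellMeasure Ω) ≤
      ENNReal.ofReal (C * 2 * L * normLBPer B Ω (v - w)) := by
    have hm : ∀ i, AEMeasurable (fun p => ENNReal.ofReal (|(v - w) p i| * |b p|))
        (cellMeasure Ω) := fun i => ((hum i).abs.mul hbm.abs).ennreal_ofReal
    refine (lintegral_mono_ae hpt).trans ?_
    rw [lintegral_const_mul' _ _ ENNReal.ofReal_ne_top, lintegral_finsetSum' _ fun i _ => hm i]
    refine (mul_le_mul_right (Finset.sum_le_sum fun i _ => hholder i) _).trans (le_of_eq ?_)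
    have h0 : ∀ i, 0 ≤ luxNorm B (cellMeasure Ω) (fun p => (v - w) p i) :=
      fun i => luxNorm_nonneg
    rw [← ENNReal.ofReal_sum_of_nonneg (fun i _ => mul_nonneg (mul_nonneg zero_le_two (h0 i)) hL0),
      ← ENNReal.ofReal_mul hC.le, ← Finset.sum_mul, ← Finset.mul_sum]
    congr 1
    change C * (2 * normLBPer B Ω (v - w) * L) = _
    ring
  have hnorm := norm_integral_le_lintegral_norm (μ := cellMeasure Ω)
    (fun p => |(superpos f v - superpos f w) p|)
  calc normL1 Ω (superpos f v - superpos f w)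
      ≤ ‖∫ p, |(superpos f v - superpos f w) p| ∂(cellMeasure Ω)‖ := le_abs_self _
    _ ≤ _ := hnorm
    _ ≤ (ENNReal.ofReal (C * 2 * L * normLBPer B Ω (v - w))).toReal :=
        ENNReal.toReal_mono ENNReal.ofReal_ne_top hle
    _ = C * 2 * L * normLBPer B Ω (v - w) := ENNReal.toReal_ofReal (by positivity)

/-- Norm balls of radius one are contained in modular balls. -/
lemma modular_sub_le_one_of_normLBPer_lt (hB : IsNFunction B) (h2 : IsDelta2 B)
    (hΩb : Bornology.IsBounded Ω) (hv : MemLBPer B Ω v) (hw : MemLBPer B Ω w)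
    (h : normLBPer B Ω (w - v) < 1) (i : Fin N) :
    ∫⁻ p, ENNReal.ofReal (B |w p i - v p i|) ∂(cellMeasure Ω) ≤ 1 := by
  have := isFiniteMeasure_cellMeasure hΩb
  have hfin : ∫⁻ p, ENNReal.ofReal (B |w p i - v p i|) ∂(cellMeasure Ω) ≠ ⊤ := by
    simpa using modular_sub_ne_top hB h2 (hw i).aemeasurable (hw i).modular_lt_top.ne
      (hv i).modular_lt_top.ne zero_le_one
  have hi : luxNorm B (cellMeasure Ω) (fun p => w p i - v p i) < 1 :=
    (Finset.single_le_sum (f := fun i => luxNorm B (cellMeasure Ω) (fun p => (w - v) p i))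
      (fun i _ => luxNorm_nonneg) (Finset.mem_univ i)).trans_lt h
  obtain ⟨k, hk, hk1, hkI⟩ := exists_modular_le_one_of_luxNorm_lt
    (fun θ t h0 h1 ht => hB.map_mul_le h0 h1 ht) hfin hi
  refine le_trans (lintegral_mono fun p => ENNReal.ofReal_le_ofReal ?_) hkI
  exact hB.mono (abs_nonneg _) (le_div_self (abs_nonneg _) hk hk1.le)

lemma IsIntegrand.isContExtension_superpos (hB : IsNFunction B) (h2 : IsDelta2 B)
    (hΩb : Bornology.IsBounded Ω) (hf : IsIntegrand B f) :
    IsContExtension B Ω f (superpos f) := by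
  refine ⟨fun v hv => hf.memL1Per_superpos hB h2 hΩb hv, fun v hv η hη => ?_,
    fun v _ => EventuallyEq.rfl⟩
  obtain ⟨c, hc, hlip⟩ := hf.exists_normL1_sub_le hB h2 hΩb
  obtain ⟨K, hK, hbd⟩ := exists_modular_density_le hB h2 hΩb hv
  set R := c * (1 + K.toReal) with hR
  have hR0 : 0 < R := by positivity
  refine ⟨min 1 (η / R), by positivity, fun w hw hwv => ?_⟩
  have h3 := hbd w hw (modular_sub_le_one_of_normLBPer_lt hB h2 hΩb hv hw
    (hwv.trans_le (min_le_left _ _)))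
  have h4 : luxNorm (conj B) (cellMeasure Ω) (fun p => density B (1 + ‖w p‖ + ‖v p‖)) ≤
      1 + K.toReal :=
    (luxNorm_le_one_add (fun θ t h0 h1 _ => hB.conj_mul_le h0 h1)
      (ne_top_of_le_ne_top hK h3)).trans (by gcongr)
  have hn0 : 0 ≤ normLBPer B Ω (w - v) := Finset.sum_nonneg fun i _ => luxNorm_nonneg
  calc normL1 Ω (superpos f w - superpos f v) ≤ _ := hlip w v hw hv
    _ ≤ R * normLBPer B Ω (w - v) := by rw [hR]; gcongr
    _ < R * (η / R) := by
        gcongr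
        exact hwv.trans_le (min_le_right _ _)
    _ = η := by field_simp

end Superposition

/-! ### The torus -/

section Torus

variable {N : ℕ}

/-- The torus `ℝ^N / ℤ^N`; periodic functions are treated as functions on it. -/
abbrev Torus (N : ℕ) : Type := UnitAddTorus (Fin N)

instance : BorelSpace (E N × Torus N × Torus N) := Prod.borelSpace

/-- The quotient map `ℝ^N → ℝ^N / ℤ^N`. -/
def toTorus (y : E N) : Torus N := fun i => (y i : UnitAddCircle)

/-- The section of `toTorus` with values in the half-open cube `]-1/2, 1/2]^N`. It is Borel but
not continuous. -/
noncomputable def fromTorus (t : Torus N) : E N :=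
  WithLp.toLp 2 fun i => (AddCircle.equivIoc (1 : ℝ) (-(1 / 2)) (t i) : ℝ)

lemma isOpenQuotientMap_toTorus : IsOpenQuotientMap (toTorus (N := N)) :=
  (IsOpenQuotientMap.piMap fun _ : Fin N => QuotientAddGroup.isOpenQuotientMap_mk).comp
    (PiLp.homeomorph 2 fun _ : Fin N => ℝ).isOpenQuotientMap

lemma continuous_toTorus : Continuous (toTorus (N := N)) :=
  isOpenQuotientMap_toTorus.continuous

lemma toTorus_fromTorus (t : Torus N) : toTorus (fromTorus t) = t :=
  funext fun _ => AddCircle.coe_equivIoc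

lemma fromTorus_toTorus {y : E N} (hy : y ∈ cube N) : fromTorus (toTorus y) = y := by
  ext i
  have h := (hy i).2
  exact AddCircle.equivIoc_coe_of_mem ⟨(hy i).1, by linarith⟩

lemma fromTorus_mem (t : Torus N) (i : Fin N) : fromTorus t i ∈ Icc (-(1 / 2) : ℝ) (1 / 2) := by
  have h := (AddCircle.equivIoc (1 : ℝ) (-(1 / 2)) (t i)).2
  refine ⟨h.1.le, ?_⟩
  have h2 := h.2
  change ((AddCircle.equivIoc (1 : ℝ) (-(1 / 2)) (t i)) : ℝ) ≤ 1 / 2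
  linarith

lemma measurable_fromTorus : Measurable (fromTorus (N := N)) := by
  refine (WithLp.measurable_toLp 2 _).comp (measurable_pi_lambda _ fun i => ?_)
  exact measurable_subtype_coe.comp
    ((AddCircle.measurableEquivIoc (1 : ℝ) (-(1 / 2))).measurable.comp (measurable_pi_apply i))

lemma toTorus_add_lat (y : E N) (k : Fin N → ℤ) : toTorus (y + lat k) = toTorus y := by
  funext i
  simp [toTorus, lat]

lemma exists_eq_add_lat {y z : E N} (h : toTorus y = toTorus z) :
    ∃ k : Fin N → ℤ, y = z + lat k := by
  have h1 : ∀ i, ∃ k : ℤ, y i = z i + k := fun i => by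
    have h2 : ((y i : ℝ) : UnitAddCircle) = ((z i : ℝ) : UnitAddCircle) := congrFun h i
    obtain ⟨k, hk⟩ := AddSubgroup.mem_zmultiples_iff.1 (QuotientAddGroup.eq.1 h2.symm)
    refine ⟨k, ?_⟩
    rw [zsmul_eq_mul, mul_one] at hk
    linarith
  choose k hk using h1
  refine ⟨k, ?_⟩
  ext i
  simpa [lat] using hk i

lemma exists_fromTorus_eq (y : E N) : ∃ k : Fin N → ℤ, fromTorus (toTorus y) = y + lat k :=
  exists_eq_add_lat (toTorus_fromTorus _)

/-- Functions are approximated in `L¹` by continuous functions of `π`, provided that `π` has an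
almost everywhere left inverse. -/
lemma exists_continuous_comp_approx {α β V : Type*} [MeasurableSpace α] {μ : Measure α}
    [IsFiniteMeasure μ] [TopologicalSpace β] [TopologicalSpace.PseudoMetrizableSpace β]
    [MeasurableSpace β] [BorelSpace β] [NormedAddCommGroup V] [NormedSpace ℝ V]
    [SecondCountableTopologyEither β V] {π : α → β} (hπ : Measurable π) {s : β → α} (hs : Measurable s)
    (hsπ : ∀ᵐ p ∂μ, s (π p) = p) {u : α → V} (hu : Integrable u μ) {ε : ENNReal} (hε : ε ≠ 0) :
    ∃ g : BoundedContinuousFunction β V, ∫⁻ p, ‖u p - g (π p)‖ₑ ∂μ ≤ ε := by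
  let _ := TopologicalSpace.pseudoMetrizableSpacePseudoMetric β
  set u₀ := hu.1.mk with hu₀
  have hae : ∀ᵐ p ∂μ, u p = u₀ (s (π p)) := by
    filter_upwards [hu.1.ae_eq_mk, hsπ] with p h1 h2
    rw [h2, h1]
  have hsm : StronglyMeasurable (u₀ ∘ s) := hu.1.stronglyMeasurable_mk.comp_measurable hs
  have hint : Integrable (u₀ ∘ s) (μ.map π) :=
    (integrable_map_measure hsm.aestronglyMeasurable hπ.aemeasurable).2 (hu.congr hae)
  obtain ⟨g, hg, -⟩ := hint.exists_boundedContinuous_lintegral_sub_le hε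
  refine ⟨g, le_trans (le_of_eq ?_) hg⟩
  rw [lintegral_map' _ hπ.aemeasurable]
  · refine lintegral_congr_ae ?_
    filter_upwards [hae] with p hp
    rw [hp]; rfl
  · exact (hsm.aestronglyMeasurable.sub g.continuous.aestronglyMeasurable).enorm

end Torus

/-! ### Density of the continuous periodic functions -/

section Density

lemma abs_clip_sub_clip_le (n a b : ℝ) :
    |max (-n) (min a n) - max (-n) (min b n)| ≤ |a - b| := by
  have h1 := abs_max_sub_max_le_max (-n) (min a n) (-n) (min b n)
  have h2 := abs_min_sub_min_le_max a n b n
  rw [sub_self, abs_zero, max_eq_right (abs_nonneg (min a n - min b n))] at h1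
  rw [sub_self, abs_zero, max_eq_left (abs_nonneg (a - b))] at h2
  exact h1.trans h2

lemma abs_clip_le {n : ℝ} (hn : 0 ≤ n) (a : ℝ) : |max (-n) (min a n)| ≤ n :=
  abs_le.2 ⟨le_max_left _ _, max_le (by linarith) (min_le_right _ _)⟩

lemma clip_eq_self {n a : ℝ} (h : |a| ≤ n) : max (-n) (min a n) = a := by
  rw [min_eq_left (abs_le.1 h).2, max_eq_right (abs_le.1 h).1]

lemma abs_sub_clip_le {n : ℝ} (hn : 0 ≤ n) (a : ℝ) : |a - max (-n) (min a n)| ≤ |a| := by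
  rcases le_total 0 a with h | h
  · rw [max_eq_right (le_trans (by linarith) (le_min h hn)), abs_of_nonneg h,
      abs_of_nonneg (sub_nonneg.2 (min_le_left _ _))]
    linarith [le_min h hn]
  · rw [min_eq_left (by linarith), abs_of_nonpos h,
      abs_of_nonpos (sub_nonpos.2 (le_max_right _ _))]
    linarith [max_le (show -n ≤ 0 by linarith) h]

/-- Approximation in modular: truncation reduces to bounded functions, on which the modular is
dominated by the `L¹` norm. -/
lemma exists_continuous_modular_le {B : ℝ → ℝ} (hB : IsNFunction B) (h2 : IsDelta2 B)
    {α β : Type*} [MeasurableSpace α] {μ : Measure α}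
    [IsFiniteMeasure μ] [TopologicalSpace β] [TopologicalSpace.PseudoMetrizableSpace β]
    [MeasurableSpace β] [BorelSpace β]
    {π : α → β} (hπ : Measurable π) {s : β → α} (hs : Measurable s)
    (hsπ : ∀ᵐ p ∂μ, s (π p) = p) {u : α → ℝ} (hum : AEMeasurable u μ)
    (hu : ∫⁻ p, ENNReal.ofReal (B |u p|) ∂μ ≠ ⊤) {k : ℝ} (hk : 0 < k) :
    ∃ g : β → ℝ, Continuous g ∧ ∫⁻ p, ENNReal.ofReal (B (|u p - g (π p)| / k)) ∂μ ≤ 1 := by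
  set T : ℝ → ℝ → ℝ := fun n a => max (-n) (min a n) with hT
  have hTc : ∀ n, Continuous (T n) := fun n => by fun_prop
  have hBc : Continuous fun a : ℝ => B (2 / k * |a|) := by
    have := hB.continuous_comp_norm.comp (continuous_const_smul (T := ℝ) (2 / k))
    refine this.congr fun a => ?_
    simp only [Function.comp]
    rw [norm_smul, Real.norm_of_nonneg (by positivity), Real.norm_eq_abs]
  have hdom : ∫⁻ p, ENNReal.ofReal (B (2 / k * |u p|)) ∂μ ≠ ⊤ := by
    obtain ⟨a, ha, M, hM, h⟩ := hB.exists_map_mul_le h2 (show 0 ≤ 2 / k by positivity)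
    exact lintegral_ofReal_ne_top_of_le ha hu (ae_of_all _ fun p => h _ (abs_nonneg _))
  have htrunc : Tendsto (fun n : ℕ => ∫⁻ p, ENNReal.ofReal (B (2 / k * |u p - T n (u p)|)) ∂μ)
      atTop (𝓝 (∫⁻ _, 0 ∂μ)) := by
    refine tendsto_lintegral_of_dominated_convergence' _ (fun n => ?_)
      (fun n => ae_of_all _ fun p => ?_) hdom (ae_of_all _ fun p => ?_)
    · exact (hBc.measurable.comp_aemeasurable
        (hum.sub ((hTc n).measurable.comp_aemeasurable hum))).ennreal_ofReal
    · refine ENNReal.ofReal_le_ofReal (hB.mono (by positivity) ?_)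
      exact mul_le_mul_of_nonneg_left (abs_sub_clip_le (Nat.cast_nonneg n) _) (by positivity)
    · refine tendsto_const_nhds.congr' ?_
      obtain ⟨m, hm⟩ := exists_nat_ge |u p|
      filter_upwards [eventually_ge_atTop m] with n hn
      have : T n (u p) = u p := clip_eq_self (hm.trans (by exact_mod_cast hn))
      simp [this, hB.map_zero]
  rw [lintegral_zero] at htrunc
  obtain ⟨n, hn⟩ := (htrunc.eventually_le_const (show (0 : ENNReal) < 2⁻¹ by simp)).exists
  have hn0 : (0 : ℝ) ≤ n := Nat.cast_nonneg n
  -- on `[0, R]` the function `t ↦ B (2 t / k)` is at most `C t`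
  set R : ℝ := 2 * n + 1 with hR
  have hR0 : 0 < R := by positivity
  set C : ℝ := B (2 / k * R) / R with hC
  have hC0 : 0 ≤ C := div_nonneg (hB.nonneg (by positivity)) hR0.le
  have hlin : ∀ t, 0 ≤ t → t ≤ R → B (2 / k * t) ≤ C * t := fun t ht htR => by
    have h := hB.map_mul_le (div_nonneg ht hR0.le) ((div_le_one hR0).2 htR)
      (show 0 ≤ 2 / k * R by positivity)
    rw [show t / R * (2 / k * R) = 2 / k * t by field_simp] at h
    exact h.trans_eq (by rw [hC]; ring)
  set w : α → ℝ := fun p => T n (u p) with hw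
  have hwm : AEMeasurable w μ := (hTc n).measurable.comp_aemeasurable hum
  have hwi : Integrable w μ := by
    refine Integrable.of_bound hwm.aestronglyMeasurable n (ae_of_all _ fun p => ?_)
    exact abs_clip_le hn0 _
  obtain ⟨g, hg⟩ := exists_continuous_comp_approx hπ hs hsπ hwi
    (ε := ENNReal.ofReal (1 / (2 * (C + 1)))) (by
      rw [Ne, ENNReal.ofReal_eq_zero, not_le]; positivity)
  refine ⟨fun b => T n (g b), (hTc n).comp g.continuous, ?_⟩
  have hpt : ∀ p, ENNReal.ofReal (B (|u p - T n (g (π p))| / k)) ≤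
      ENNReal.ofReal (B (2 / k * |u p - w p|)) + ENNReal.ofReal C * ‖w p - g (π p)‖ₑ := by
    intro p
    have h3 : |w p - T n (g (π p))| ≤ |w p - g (π p)| := by
      have h := abs_clip_sub_clip_le n (w p) (g (π p))
      rwa [clip_eq_self (abs_clip_le hn0 (u p))] at h
    have h4 : |w p - T n (g (π p))| ≤ R := by
      have h5 := abs_sub (w p) (T n (g (π p)))
      have h6 : |w p| ≤ n := abs_clip_le hn0 (u p)
      have h7 : |T n (g (π p))| ≤ n := abs_clip_le hn0 (g (π p))
      linarith
    rw [Real.enorm_eq_ofReal_abs, ← ENNReal.ofReal_mul hC0,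
      ← ENNReal.ofReal_add (hB.nonneg (by positivity)) (by positivity)]
    refine ENNReal.ofReal_le_ofReal ?_
    have h5 : |u p - T n (g (π p))| / k ≤ |u p - w p| / k + |w p - T n (g (π p))| / k := by
      rw [← add_div]
      gcongr
      exact abs_sub_le _ _ _
    have h6 := hB.add_le (show 0 ≤ |u p - w p| / k by positivity)
      (show 0 ≤ |w p - T n (g (π p))| / k by positivity)
    have h7 := hlin _ (abs_nonneg _) h4
    rw [show 2 * (|u p - w p| / k) = 2 / k * |u p - w p| by ring,
      show 2 * (|w p - T n (g (π p))| / k) = 2 / k * |w p - T n (g (π p))| by ring] at h6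
    have h8 : C * |w p - T n (g (π p))| ≤ C * |w p - g (π p)| := by gcongr
    linarith [hB.mono (by positivity) h5]
  calc ∫⁻ p, ENNReal.ofReal (B (|u p - T n (g (π p))| / k)) ∂μ
      ≤ ∫⁻ p, (ENNReal.ofReal (B (2 / k * |u p - w p|)) +
          ENNReal.ofReal C * ‖w p - g (π p)‖ₑ) ∂μ := lintegral_mono hpt
    _ = ∫⁻ p, ENNReal.ofReal (B (2 / k * |u p - w p|)) ∂μ +
          ENNReal.ofReal C * ∫⁻ p, ‖w p - g (π p)‖ₑ ∂μ := by
        have hm : AEMeasurable (fun p => ENNReal.ofReal (B (2 / k * |u p - w p|))) μ :=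
          (hBc.measurable.comp_aemeasurable (hum.sub hwm)).ennreal_ofReal
        rw [lintegral_add_left' hm, lintegral_const_mul' _ _ ENNReal.ofReal_ne_top]
    _ ≤ 2⁻¹ + ENNReal.ofReal C * ENNReal.ofReal (1 / (2 * (C + 1))) := by gcongr
    _ ≤ 2⁻¹ + ENNReal.ofReal 2⁻¹ := by
        rw [← ENNReal.ofReal_mul hC0]
        gcongr
        rw [mul_one_div, div_le_iff₀ (by positivity)]
        linarith
    _ = 1 := by
        rw [ENNReal.ofReal_inv_of_pos two_pos, ENNReal.ofReal_ofNat, ENNReal.inv_two_add_inv_two]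

variable {N : ℕ} {B : ℝ → ℝ} {Ω : Set (E N)} {v : E N × E N × E N → E N}

lemma IsContPer.exists_bound (hΩb : Bornology.IsBounded Ω) (hv : IsContPer Ω v) :
    ∃ C, ∀ x ∈ closure Ω, ∀ y z, ‖v (x, y, z)‖ ≤ C := by
  obtain ⟨C, hC⟩ := ((hΩb.isCompact_closure).prod
    (isCompact_closedCube.prod isCompact_closedCube)).exists_bound_of_continuousOn
      (hv.1.mono (prod_mono_right (subset_univ _)))
  refine ⟨C, fun x hx y z => ?_⟩
  obtain ⟨k, hk⟩ := exists_fromTorus_eq y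
  obtain ⟨h, hh⟩ := exists_fromTorus_eq z
  rw [← hv.2 x hx k h y z, ← hk, ← hh]
  exact hC _ ⟨hx, fromTorus_mem _, fromTorus_mem _⟩

lemma IsContPer.memLBPer (hB : IsNFunction B) (hΩ : IsOpen Ω) (hΩb : Bornology.IsBounded Ω)
    (hv : IsContPer Ω v) : MemLBPer B Ω v := by
  have := isFiniteMeasure_cellMeasure hΩb
  intro i
  refine ⟨?_, ?_, ?_⟩
  · have h : ContinuousOn (fun p => v p i) (Ω ×ˢ univ) := by
      have := hv.1.mono (prod_mono_left (t := univ) (subset_closure (s := Ω)))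
      fun_prop
    exact h.aestronglyMeasurable (hΩ.measurableSet.prod MeasurableSet.univ)
  · filter_upwards [ae_restrict_mem hΩ.measurableSet] with x hx k h
    exact ae_of_all _ fun q => by rw [hv.2 x (subset_closure hx)]
  · obtain ⟨C, hC⟩ := hv.exists_bound hΩb
    refine (lintegral_ofReal_ne_top_of_le (G := fun _ => (0 : ℝ)) (M := B C) zero_le_one
      (by simp) ?_).lt_top
    have hmeas : MeasurableSet (Ω ×ˢ (cube N ×ˢ cube N)) :=
      hΩ.measurableSet.prod (isOpen_cube.measurableSet.prod isOpen_cube.measurableSet)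
    filter_upwards [ae_restrict_mem hmeas] with p hp
    have h1 : |v p i| ≤ C := (PiLp.norm_apply_le (v p) i).trans
      (hC p.1 (subset_closure hp.1) p.2.1 p.2.2)
    simpa using hB.mono (abs_nonneg _) h1

lemma exists_isContPer_normLBPer_lt (hB : IsNFunction B) (h2 : IsDelta2 B) (hΩ : IsOpen Ω)
    (hΩb : Bornology.IsBounded Ω) (hv : MemLBPer B Ω v) {δ : ℝ} (hδ : 0 < δ) :
    ∃ w, IsContPer Ω w ∧ normLBPer B Ω (w - v) < δ := by
  have := isFiniteMeasure_cellMeasure hΩb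
  set π : E N × E N × E N → E N × Torus N × Torus N :=
    fun p => (p.1, toTorus p.2.1, toTorus p.2.2) with hπ
  set s : E N × Torus N × Torus N → E N × E N × E N :=
    fun p => (p.1, fromTorus p.2.1, fromTorus p.2.2) with hs
  have hπc : Continuous π := continuous_fst.prodMk
    ((continuous_toTorus.comp (continuous_fst.comp continuous_snd)).prodMk
      (continuous_toTorus.comp (continuous_snd.comp continuous_snd)))
  have hsm : Measurable s := measurable_fst.prodMk
    ((measurable_fromTorus.comp (measurable_fst.comp measurable_snd)).prodMk
      (measurable_fromTorus.comp (measurable_snd.comp measurable_snd)))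
  have hsπ : ∀ᵐ p ∂(cellMeasure Ω), s (π p) = p := by
    have hmeas : MeasurableSet (Ω ×ˢ (cube N ×ˢ cube N)) :=
      hΩ.measurableSet.prod (isOpen_cube.measurableSet.prod isOpen_cube.measurableSet)
    filter_upwards [ae_restrict_mem hmeas] with p hp
    simp only [hs, hπ, fromTorus_toTorus hp.2.1, fromTorus_toTorus hp.2.2]
  set k := δ / (N + 1) with hk
  have hk0 : 0 < k := by positivity
  have hex := fun i => exists_continuous_modular_le hB h2 hπc.measurable hsm hsπ
    (hv i).aemeasurable (hv i).modular_lt_top.ne hk0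
  choose g hgc hg using hex
  refine ⟨fun p => WithLp.toLp 2 fun i => g i (π p), ⟨?_, ?_⟩, ?_⟩
  · refine Continuous.continuousOn ?_
    exact (PiLp.continuous_toLp 2 _).comp (continuous_pi fun i => (hgc i).comp hπc)
  · intro x _ k h y z
    simp only [hπ, toTorus_add_lat]
  · have hi : ∀ i, luxNorm B (cellMeasure Ω)
        (fun p => ((fun p => WithLp.toLp 2 fun i => g i (π p)) - v) p i) ≤ k := fun i => by
      refine luxNorm_le hk0 ?_
      simpa [abs_sub_comm] using hg i
    calc normLBPer B Ω _ ≤ ∑ _i : Fin N, k := Finset.sum_le_sum fun i _ => hi i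
      _ = N * k := by simp
      _ < (N + 1) * k := by nlinarith
      _ = δ := by rw [hk]; field_simp

/-- Two continuous extensions agree, because they agree on the dense set of continuous periodic
functions. -/
lemma IsContExtension.ae_eq {f : E N → E N → E N → ℝ} (hB : IsNFunction B) (h2 : IsDelta2 B)
    (hΩ : IsOpen Ω) (hΩb : Bornology.IsBounded Ω)
    {Φ Ψ : (E N × E N × E N → E N) → (E N × E N × E N → ℝ)} (hΦ : IsContExtension B Ω f Φ)
    (hΨ : IsContExtension B Ω f Ψ) (hv : MemLBPer B Ω v) : Ψ v =ᵐ[cellMeasure Ω] Φ v := by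
  have hΦi := (hΦ.mapsTo v hv).integrable
  have hΨi := (hΨ.mapsTo v hv).integrable
  have hzero : ∫ p, |Ψ v p - Φ v p| ∂(cellMeasure Ω) = 0 := by
    refine le_antisymm (le_of_forall_pos_le_add fun η hη => ?_)
      (integral_nonneg fun p => abs_nonneg _)
    obtain ⟨δ₁, hδ₁, h1⟩ := hΦ.continuous v hv (η / 2) (by positivity)
    obtain ⟨δ₂, hδ₂, h3⟩ := hΨ.continuous v hv (η / 2) (by positivity)
    obtain ⟨w, hw, hwv⟩ := exists_isContPer_normLBPer_lt hB h2 hΩ hΩb hv (lt_min hδ₁ hδ₂)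
    have hwm := hw.memLBPer hB hΩ hΩb
    have h4 := h1 w hwm (hwv.trans_le (min_le_left _ _))
    have h5 := h3 w hwm (hwv.trans_le (min_le_right _ _))
    have hΦw := (hΦ.mapsTo w hwm).integrable
    have hΨw := (hΨ.mapsTo w hwm).integrable
    have heq : Ψ w =ᵐ[cellMeasure Ω] Φ w :=
      (hΨ.extends_superpos w hw).trans (hΦ.extends_superpos w hw).symm
    have h6 : ∫ p, |Ψ v p - Φ v p| ∂(cellMeasure Ω) ≤
        ∫ p, (|(Ψ w - Ψ v) p| + |(Φ w - Φ v) p|) ∂(cellMeasure Ω) := by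
      refine integral_mono_ae (hΨi.sub hΦi).abs ((hΨw.sub hΨi).abs.add (hΦw.sub hΦi).abs) ?_
      filter_upwards [heq] with p hp
      simp only [Pi.sub_apply, hp]
      rw [abs_sub_comm (Φ w p) (Ψ v p)]
      exact abs_sub_le _ _ _
    rw [integral_add (hΨw.sub hΨi).abs (hΦw.sub hΦi).abs] at h6
    change _ ≤ normL1 Ω (Ψ w - Ψ v) + normL1 Ω (Φ w - Φ v) at h6
    linarith
  have h7 := (integral_eq_zero_iff_of_nonneg (fun p => abs_nonneg _) (hΨi.sub hΦi).abs).1 hzero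
  filter_upwards [h7] with p hp
  exact sub_eq_zero.1 (abs_eq_zero.1 hp)

end Density

/-! ### Oscillating integrals of continuous functions -/

section Oscillation

/-- Limits pass to uniform approximations of the family and of its limit. -/
lemma tendsto_of_approx {ι V : Type*} [SeminormedAddCommGroup V] {l : Filter ι} {a : ι → V} {a₀ : V}
    (h : ∀ η > 0, ∃ a' : ι → V, ∃ a₀', Tendsto a' l (𝓝 a₀') ∧ (∀ᶠ i in l, ‖a i - a' i‖ ≤ η) ∧
      ‖a₀ - a₀'‖ ≤ η) : Tendsto a l (𝓝 a₀) := by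
  refine Metric.tendsto_nhds.2 fun η hη => ?_
  obtain ⟨a', a₀', h1, h2, h3⟩ := h (η / 4) (by positivity)
  filter_upwards [h2, Metric.tendsto_nhds.1 h1 (η / 4) (by positivity)] with i h4 h5
  rw [← dist_eq_norm] at h3 h4
  rw [dist_comm] at h3
  linarith [dist_triangle4 (a i) (a' i) a₀' a₀]

/-- Weak convergence of measures of bounded mass on a compact space need only be tested on a set
of functions with dense linear span. -/
lemma tendsto_integral_of_dense_span {ι K : Type*} [TopologicalSpace K] [CompactSpace K]
    [TopologicalSpace.PseudoMetrizableSpace K] [MeasurableSpace K] [BorelSpace K]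
    {l : Filter ι} {ν : ι → Measure K} {ν₀ : Measure K} [∀ i, IsFiniteMeasure (ν i)]
    [IsFiniteMeasure ν₀] {C : ℝ} (hC : ∀ i, (ν i).real univ ≤ C) (hC₀ : ν₀.real univ ≤ C)
    {M : Set C(K, ℂ)} (hM : (Submodule.span ℂ M).topologicalClosure = ⊤)
    (h : ∀ G ∈ M, Tendsto (fun i => ∫ x, G x ∂(ν i)) l (𝓝 (∫ x, G x ∂ν₀))) (G : C(K, ℂ)) :
    Tendsto (fun i => ∫ x, G x ∂(ν i)) l (𝓝 (∫ x, G x ∂ν₀)) := by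
  have hint : ∀ (G : C(K, ℂ)) (μ : Measure K) [IsFiniteMeasure μ], Integrable G μ := fun G μ _ =>
    Integrable.of_bound G.continuous.aestronglyMeasurable ‖G‖
      (ae_of_all _ fun x => G.norm_coe_le_norm x)
  have hspan : ∀ G ∈ Submodule.span ℂ M,
      Tendsto (fun i => ∫ x, G x ∂(ν i)) l (𝓝 (∫ x, G x ∂ν₀)) := by
    intro G hG
    induction hG using Submodule.span_induction with
    | mem G hG => exact h G hG
    | zero => simpa using tendsto_const_nhds
    | add G G' _ _ h1 h2 =>
      simp only [ContinuousMap.add_apply]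
      simp only [fun μ [IsFiniteMeasure μ] => integral_add (hint G μ) (hint G' μ)]
      exact h1.add h2
    | smul c G _ h1 =>
      simp only [ContinuousMap.smul_apply, integral_smul]
      exact h1.const_smul c
  have hC' : 0 ≤ C := measureReal_nonneg.trans hC₀
  refine tendsto_of_approx fun η hη => ?_
  have hG : G ∈ closure (Submodule.span ℂ M : Set C(K, ℂ)) := by
    rw [← Submodule.topologicalClosure_coe, hM]; trivial
  obtain ⟨G', hG', hGG'⟩ := Metric.mem_closure_iff.1 hG (η / (C + 1)) (by positivity)
  have hle : ∀ (μ : Measure K) [IsFiniteMeasure μ], μ.real univ ≤ C →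
      ‖∫ x, G x ∂μ - ∫ x, G' x ∂μ‖ ≤ η := fun μ _ hμ => by
    rw [← integral_sub (hint G μ) (hint G' μ)]
    calc ‖∫ x, (G x - G' x) ∂μ‖ ≤ η / (C + 1) * μ.real univ := by
          refine norm_integral_le_of_norm_le_const (ae_of_all _ fun x => ?_)
          rw [← dist_eq_norm]
          exact (ContinuousMap.dist_apply_le_dist x).trans hGG'.le
      _ ≤ η / (C + 1) * (C + 1) := by gcongr; linarith
      _ = η := by field_simp
  exact ⟨_, _, hspan G' hG', Eventually.of_forall fun i => hle (ν i) (hC i), hle ν₀ hC₀⟩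

variable {N : ℕ}

lemma setIntegral_cube_mFourier (k : Fin N → ℤ) :
    ∫ y in cube N, UnitAddTorus.mFourier k (toTorus y) = if k = 0 then 1 else 0 := by
  have h1 : ∀ n : ℤ, ∫ t in Ioo (-(1 / 2) : ℝ) (1 / 2), fourier n (t : UnitAddCircle) =
      if n = 0 then 1 else 0 := fun n => by
    have h := fourierCoeff_eq_intervalIntegral (T := 1) (fourier n : UnitAddCircle → ℂ) 0
      (-(1 / 2))
    rw [fourierCoeff_fourier, show (-(1 / 2) : ℝ) + 1 = 1 / 2 by norm_num,
      intervalIntegral.integral_of_le (by norm_num), integral_Ioc_eq_integral_Ioo] at h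
    simp only [neg_zero, fourier_zero, one_smul, div_one, Pi.single_apply] at h
    rw [← h]
    simp [eq_comm]
  have h2 : cube N = WithLp.ofLp ⁻¹' (univ.pi fun _ : Fin N => Ioo (-(1 / 2) : ℝ) (1 / 2)) := by
    ext y; simp [cube]
  have h3 := (PiLp.volume_preserving_ofLp (Fin N)).setIntegral_preimage_emb
    (MeasurableEquiv.toLp 2 (Fin N → ℝ)).symm.measurableEmbedding
    (fun x => ∏ i, fourier (k i) (x i : UnitAddCircle))
    (univ.pi fun _ : Fin N => Ioo (-(1 / 2) : ℝ) (1 / 2))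
  rw [h2]
  refine h3.trans ?_
  rw [volume_pi, Measure.restrict_pi_pi,
    integral_fintype_prod_eq_prod (fun i (t : ℝ) => fourier (k i) (t : UnitAddCircle))]
  simp only [h1]
  rw [Finset.prod_ite_zero]
  simp [funext_iff]

lemma mFourier_toTorus (k : Fin N → ℤ) (y : E N) :
    UnitAddTorus.mFourier k (toTorus y) = Real.fourierChar (inner ℝ y (lat k)) := by
  rw [Real.fourierChar_apply, PiLp.inner_apply]
  simp only [UnitAddTorus.mFourier, toTorus, ContinuousMap.coe_mk, fourier_coe_apply]
  rw [← Complex.exp_sum]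
  congr 1
  push_cast
  rw [Finset.mul_sum, Finset.sum_mul]
  refine Finset.sum_congr rfl fun i _ => ?_
  simp [lat]
  ring

lemma lat_ne_zero {k : Fin N → ℤ} (hk : k ≠ 0) : lat k ≠ 0 := fun h => hk <| funext fun i => by
  have := congrArg (fun y : E N => y i) h
  simpa [lat] using this

/-- The two frequencies `1/ε` and `1/ε²` cannot cancel each other in the limit. -/
lemma tendsto_frequency_cocompact {k l : Fin N → ℤ} (h : ¬ (k = 0 ∧ l = 0)) :
    Tendsto (fun ε : ℝ => -(ε⁻¹ • lat k + (ε ^ 2)⁻¹ • lat l : E N)) (𝓝[>] 0) (cocompact (E N)) := by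
  rw [← Metric.cobounded_eq_cocompact, ← tendsto_norm_atTop_iff_cobounded]
  simp only [norm_neg]
  have hinv : Tendsto (fun ε : ℝ => ε⁻¹) (𝓝[>] 0) atTop := tendsto_inv_nhdsGT_zero
  rcases eq_or_ne l 0 with rfl | hl
  · have hk : k ≠ 0 := fun hk => h ⟨hk, rfl⟩
    have hpos : 0 < ‖(lat k : E N)‖ := norm_pos_iff.2 (lat_ne_zero hk)
    refine (hinv.atTop_mul_const hpos).congr' ?_
    filter_upwards [self_mem_nhdsWithin] with ε hε
    have hε0 : (0 : ℝ) < ε := hε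
    have h0 : (lat 0 : E N) = 0 := by ext i; simp [lat]
    rw [h0, smul_zero, add_zero, norm_smul, norm_inv, Real.norm_of_nonneg hε0.le]
  · have hpos : 0 < ‖(lat l : E N)‖ := norm_pos_iff.2 (lat_ne_zero hl)
    have h1 : Tendsto (fun ε : ℝ => ‖ε • lat k + lat l‖) (𝓝[>] 0) (𝓝 ‖(lat l : E N)‖) := by
      have hc : Continuous fun ε : ℝ => ‖ε • lat k + (lat l : E N)‖ := by fun_prop
      simpa using (hc.tendsto 0).mono_left (nhdsWithin_le_nhds (s := Ioi 0))
    refine ((hinv.atTop_mul_atTop₀ hinv).atTop_mul_pos hpos h1).congr' ?_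
    filter_upwards [self_mem_nhdsWithin] with ε hε
    have hε0 : (0 : ℝ) < ε := hε
    have h2 : ε⁻¹ • lat k + (ε ^ 2)⁻¹ • lat l = (ε⁻¹ * ε⁻¹) • (ε • lat k + (lat l : E N)) := by
      rw [smul_add, smul_smul]
      congr 2
      · field_simp
      · field_simp
    rw [h2, norm_smul, Real.norm_of_nonneg (by positivity)]

end Oscillation

section Closure

variable {N : ℕ} {Ω : Set (E N)}

/-- Lebesgue measure on `Ω`, as a measure on the compact space `closure Ω`. -/
noncomputable def baseMeasure (Ω : Set (E N)) : Measure (closure Ω) :=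
  (volume.restrict Ω).comap Subtype.val

lemma measurableEmbedding_closure : MeasurableEmbedding (Subtype.val : closure Ω → E N) :=
  MeasurableEmbedding.subtype_coe isClosed_closure.measurableSet

lemma map_baseMeasure : (baseMeasure Ω).map Subtype.val = volume.restrict Ω := by
  rw [baseMeasure, measurableEmbedding_closure.map_comap, Subtype.range_coe,
    Measure.restrict_restrict isClosed_closure.measurableSet,
    inter_eq_self_of_subset_right subset_closure]

lemma integral_baseMeasure {V : Type*} [NormedAddCommGroup V] [NormedSpace ℝ V] (h : E N → V) :
    ∫ x, h x ∂(baseMeasure Ω) = ∫ x in Ω, h x := by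
  rw [← map_baseMeasure, measurableEmbedding_closure.integral_map]

lemma lintegral_baseMeasure (h : E N → ENNReal) :
    ∫⁻ x, h x ∂(baseMeasure Ω) = ∫⁻ x in Ω, h x := by
  rw [← map_baseMeasure, measurableEmbedding_closure.lintegral_map]

lemma ae_baseMeasure {p : E N → Prop} (h : ∀ᵐ x ∂(volume.restrict Ω), p x) :
    ∀ᵐ x : closure Ω ∂(baseMeasure Ω), p x := by
  rw [← map_baseMeasure] at h
  exact ae_of_ae_map measurable_subtype_coe.aemeasurable h

lemma isFiniteMeasure_baseMeasure (hΩb : Bornology.IsBounded Ω) :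
    IsFiniteMeasure (baseMeasure Ω) := by
  have h : (baseMeasure Ω).map Subtype.val univ = volume Ω := by
    rw [map_baseMeasure, Measure.restrict_apply_univ]
  rw [measurableEmbedding_closure.map_apply, preimage_univ] at h
  exact ⟨h.trans_lt hΩb.measure_lt_top⟩

lemma isFiniteMeasure_cube : IsFiniteMeasure (volume.restrict (cube N)) :=
  ⟨by simpa using volume_cube_lt_top⟩

instance : BorelSpace (closure Ω × Torus N × Torus N) := Prod.borelSpace

/-- The product monomials `φ(x) e_k(y) e_l(z)` on `closure Ω × 𝕋 × 𝕋`. -/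
noncomputable def productMonomial (a : C(closure Ω, ℂ) × (Fin N → ℤ) × (Fin N → ℤ)) :
    C(closure Ω × Torus N × Torus N, ℂ) where
  toFun p := a.1 p.1 * (UnitAddTorus.mFourier a.2.1 p.2.1 * UnitAddTorus.mFourier a.2.2 p.2.2)

lemma productMonomial_mul (a b : C(closure Ω, ℂ) × (Fin N → ℤ) × (Fin N → ℤ)) :
    productMonomial a * productMonomial b = productMonomial (a.1 * b.1, a.2 + b.2) := by
  ext p
  simp only [productMonomial, ContinuousMap.mul_apply, ContinuousMap.coe_mk, Prod.fst_add,
    Prod.snd_add, UnitAddTorus.mFourier_add]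
  ring

/-- The star subalgebra generated by the product monomials. -/
noncomputable def productSubalgebra (Ω : Set (E N)) :
    StarSubalgebra ℂ C(closure Ω × Torus N × Torus N, ℂ) where
  toSubalgebra := Algebra.adjoin ℂ (range productMonomial)
  star_mem' := by
    change Algebra.adjoin ℂ (range productMonomial) ≤
      star (Algebra.adjoin ℂ (range productMonomial))
    refine Algebra.adjoin_le ?_
    rintro _ ⟨a, rfl⟩
    refine Algebra.subset_adjoin ⟨(star a.1, -a.2), ?_⟩
    ext p
    simp [productMonomial, UnitAddTorus.mFourier_neg]

lemma productSubalgebra_separatesPoints :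
    (productSubalgebra Ω).SeparatesPoints := by
  have hmem : ∀ a, ((productMonomial a : C(closure Ω × Torus N × Torus N, ℂ)) : _ → ℂ) ∈
      (fun f : C(closure Ω × Torus N × Torus N, ℂ) => (f : _ → ℂ)) ''
        (productSubalgebra Ω : Set C(closure Ω × Torus N × Torus N, ℂ)) := fun a =>
    ⟨_, Algebra.subset_adjoin ⟨a, rfl⟩, rfl⟩
  have htorus : ∀ s t : Torus N, s ≠ t → ∃ k, UnitAddTorus.mFourier k s ≠
      UnitAddTorus.mFourier k t := fun s t hst => by
    obtain ⟨i, hi⟩ := Function.ne_iff.1 hst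
    refine ⟨Pi.single i 1, ?_⟩
    rw [UnitAddTorus.mFourier_single, UnitAddTorus.mFourier_single, fourier_one, fourier_one, Ne,
      Circle.coe_inj]
    exact fun h => hi (AddCircle.injective_toCircle one_ne_zero h)
  rintro ⟨x, s, t⟩ ⟨x', s', t'⟩ hne
  by_cases hs : s = s'
  · by_cases ht : t = t'
    · have hx : (x : E N) ≠ x' := fun h => hne (by rw [hs, ht, Subtype.ext h])
      have hφ : Continuous fun y : closure Ω => ((dist (y : E N) x : ℝ) : ℂ) := by fun_prop
      refine ⟨_, hmem (⟨_, hφ⟩, 0, 0), ?_⟩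
      simp only [productMonomial, ContinuousMap.coe_mk, UnitAddTorus.mFourier_zero,
        ContinuousMap.one_apply, mul_one, dist_self]
      exact fun h => hx (dist_eq_zero.1 (Complex.ofReal_injective h).symm).symm
    · obtain ⟨k, hk⟩ := htorus t t' ht
      refine ⟨_, hmem (1, 0, k), ?_⟩
      simpa [productMonomial, UnitAddTorus.mFourier_zero] using hk
  · obtain ⟨k, hk⟩ := htorus s s' hs
    refine ⟨_, hmem (1, k, 0), ?_⟩
    simpa [productMonomial, UnitAddTorus.mFourier_zero] using hk

lemma span_productMonomial (hΩb : Bornology.IsBounded Ω) :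
    (Submodule.span ℂ (range (productMonomial (Ω := Ω)))).topologicalClosure = ⊤ := by
  have : CompactSpace (closure Ω) := isCompact_iff_compactSpace.1 hΩb.isCompact_closure
  have h1 : (productSubalgebra Ω).toSubalgebra.toSubmodule =
      Submodule.span ℂ (range (productMonomial (Ω := Ω))) := by
    apply Algebra.adjoin_eq_span_of_subset
    refine .trans (fun x ↦ Submonoid.closure_induction (fun _ ↦ id) ⟨(1, 0, 0), ?_⟩ ?_)
      Submodule.subset_span
    · ext p
      simp [productMonomial, UnitAddTorus.mFourier_zero]
    · rintro _ _ _ _ ⟨a, rfl⟩ ⟨b, rfl⟩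
      exact ⟨_, (productMonomial_mul a b).symm⟩
  rw [← h1]
  exact congr_arg (Subalgebra.toSubmodule <| StarSubalgebra.toSubalgebra ·)
    (ContinuousMap.starSubalgebra_topologicalClosure_eq_top_of_separatesPoints _
      productSubalgebra_separatesPoints)

/-- The point `(x, x/ε, x/ε²)` with the fast variables read on the torus. -/
noncomputable def oscPoint (ε : ℝ) (x : closure Ω) : closure Ω × Torus N × Torus N :=
  (x, toTorus (ε⁻¹ • (x : E N)), toTorus ((ε ^ 2)⁻¹ • (x : E N)))

lemma continuous_oscPoint (ε : ℝ) : Continuous (oscPoint (Ω := Ω) ε) :=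
  continuous_id.prodMk ((continuous_toTorus.comp (by fun_prop)).prodMk
    (continuous_toTorus.comp (by fun_prop)))

/-- Lebesgue measure on `Ω × Y × Z`, with `Ω` viewed in the compact space `closure Ω`. -/
noncomputable def baseCellMeasure (Ω : Set (E N)) : Measure (closure Ω × E N × E N) :=
  (baseMeasure Ω).prod ((volume.restrict (cube N)).prod (volume.restrict (cube N)))

lemma continuous_cellPoint : Continuous fun p : closure Ω × E N × E N =>
    (p.1, toTorus p.2.1, toTorus p.2.2) :=
  continuous_fst.prodMk
    ((continuous_toTorus.comp (continuous_fst.comp continuous_snd)).prodMk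
      (continuous_toTorus.comp (continuous_snd.comp continuous_snd)))

lemma tendsto_integral_productMonomial (hΩ : IsOpen Ω) (hΩb : Bornology.IsBounded Ω)
    (a : C(closure Ω, ℂ) × (Fin N → ℤ) × (Fin N → ℤ)) :
    Tendsto (fun ε : ℝ => ∫ x, productMonomial a (oscPoint ε x) ∂(baseMeasure Ω)) (𝓝[>] 0)
      (𝓝 (∫ p, productMonomial a (p.1, toTorus p.2.1, toTorus p.2.2) ∂(baseCellMeasure Ω))) := by
  have := isFiniteMeasure_baseMeasure hΩb
  have := isFiniteMeasure_cube (N := N)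
  obtain ⟨φ, k, l⟩ := a
  have hlim : ∫ p, productMonomial (φ, k, l) (p.1, toTorus p.2.1, toTorus p.2.2)
      ∂(baseCellMeasure Ω) = (∫ x, φ x ∂(baseMeasure Ω)) *
        ((if k = 0 then 1 else 0) * (if l = 0 then 1 else 0)) := by
    rw [← setIntegral_cube_mFourier k, ← setIntegral_cube_mFourier l,
      ← integral_prod_mul (μ := volume.restrict (cube N)) (ν := volume.restrict (cube N)),
      ← integral_prod_mul]
    rfl
  rw [hlim]
  by_cases h : k = 0 ∧ l = 0
  · obtain ⟨rfl, rfl⟩ := h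
    simp [productMonomial, oscPoint, UnitAddTorus.mFourier_zero]
  · have hzero : (if k = 0 then (1 : ℂ) else 0) * (if l = 0 then 1 else 0) = 0 := by
      rw [mul_eq_zero, ite_eq_right_iff, ite_eq_right_iff]
      by_contra hcon
      push Not at hcon
      exact h ⟨hcon.1.1, hcon.2.1⟩
    rw [hzero, mul_zero]
    -- the Riemann–Lebesgue lemma for the extension of `φ` by zero
    set φ₀ : E N → ℂ := Ω.indicator (Function.extend Subtype.val φ 0) with hφ₀
    refine ((tendsto_integral_exp_inner_smul_cocompact φ₀).comp
      (tendsto_frequency_cocompact h)).congr fun ε => ?_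
    have h1 : ∀ x : closure Ω, productMonomial (φ, k, l) (oscPoint ε x) =
        (fun x : E N => Real.fourierChar (-inner ℝ x (-(ε⁻¹ • lat k + (ε ^ 2)⁻¹ • lat l))) •
          Function.extend Subtype.val φ 0 x) x := fun x => by
      have h2 : -inner ℝ (x : E N) (-(ε⁻¹ • lat k + (ε ^ 2)⁻¹ • lat l)) =
          inner ℝ (ε⁻¹ • (x : E N)) (lat k) + inner ℝ ((ε ^ 2)⁻¹ • (x : E N)) (lat l) := by
        simp only [inner_neg_right, inner_add_right, inner_smul_right, real_inner_smul_left,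
          neg_neg]
      simp only [productMonomial, oscPoint, ContinuousMap.coe_mk, mFourier_toTorus]
      rw [h2, AddChar.map_add_eq_mul, Subtype.val_injective.extend_apply, Circle.smul_def,
        Circle.coe_mul, smul_eq_mul]
      ring
    simp only [h1]
    rw [integral_baseMeasure (fun x : E N =>
      Real.fourierChar (-inner ℝ x (-(ε⁻¹ • lat k + (ε ^ 2)⁻¹ • lat l))) •
          Function.extend Subtype.val φ 0 x), ← integral_indicator hΩ.measurableSet]
    refine integral_congr_ae (ae_of_all _ fun x => ?_)
    simp only [hφ₀, indicator]
    split_ifs <;> simp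

/-- Weak convergence of the oscillating measures on `closure Ω × 𝕋 × 𝕋`, by the
Stone–Weierstrass theorem. -/
lemma tendsto_integral_oscPoint (hΩ : IsOpen Ω) (hΩb : Bornology.IsBounded Ω)
    (G : C(closure Ω × Torus N × Torus N, ℝ)) :
    Tendsto (fun ε : ℝ => ∫ x, G (oscPoint ε x) ∂(baseMeasure Ω)) (𝓝[>] 0)
      (𝓝 (∫ p, G (p.1, toTorus p.2.1, toTorus p.2.2) ∂(baseCellMeasure Ω))) := by
  have : CompactSpace (closure Ω) := isCompact_iff_compactSpace.1 hΩb.isCompact_closure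
  have := isFiniteMeasure_baseMeasure hΩb
  have := isFiniteMeasure_cube (N := N)
  have : IsFiniteMeasure (baseCellMeasure Ω) := by unfold baseCellMeasure; infer_instance
  have hm := fun ε : ℝ => (continuous_oscPoint (Ω := Ω) ε).measurable
  have hm₀ := (continuous_cellPoint (Ω := Ω)).measurable
  have hmap : ∀ (ε : ℝ) (G : C(closure Ω × Torus N × Torus N, ℂ)),
      ∫ q, G q ∂((baseMeasure Ω).map (oscPoint ε)) = ∫ x, G (oscPoint ε x) ∂(baseMeasure Ω) :=
    fun ε G => integral_map (hm ε).aemeasurable G.continuous.aestronglyMeasurable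
  have hmap₀ : ∀ G : C(closure Ω × Torus N × Torus N, ℂ),
      ∫ q, G q ∂((baseCellMeasure Ω).map
        (fun p : closure Ω × E N × E N => (p.1, toTorus p.2.1, toTorus p.2.2))) =
      ∫ p, G (p.1, toTorus p.2.1, toTorus p.2.2) ∂(baseCellMeasure Ω) :=
    fun G => integral_map hm₀.aemeasurable G.continuous.aestronglyMeasurable
  have key := tendsto_integral_of_dense_span (l := 𝓝[>] (0 : ℝ))
    (ν := fun ε => (baseMeasure Ω).map (oscPoint ε))
    (ν₀ := (baseCellMeasure Ω).map
      (fun p : closure Ω × E N × E N => (p.1, toTorus p.2.1, toTorus p.2.2)))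
    (C := max ((baseMeasure Ω).real univ) ((baseCellMeasure Ω).real univ))
    (fun ε => by
      rw [map_measureReal_apply (hm ε) MeasurableSet.univ]
      exact le_max_left _ _)
    (by
      rw [map_measureReal_apply hm₀ MeasurableSet.univ]
      exact le_max_right _ _)
    (span_productMonomial hΩb)
    (by
      rintro _ ⟨a, rfl⟩
      simp only [hmap, hmap₀]
      exact tendsto_integral_productMonomial hΩ hΩb a)
    ⟨fun q => (G q : ℂ), by fun_prop⟩
  have hre : ∀ ε : ℝ, ∫ q, G q ∂((baseMeasure Ω).map (oscPoint ε)) =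
      ∫ x, G (oscPoint ε x) ∂(baseMeasure Ω) :=
    fun ε => integral_map (hm ε).aemeasurable G.continuous.aestronglyMeasurable
  have hre₀ : ∫ q, G q ∂((baseCellMeasure Ω).map
      (fun p : closure Ω × E N × E N => (p.1, toTorus p.2.1, toTorus p.2.2))) =
      ∫ p, G (p.1, toTorus p.2.1, toTorus p.2.2) ∂(baseCellMeasure Ω) :=
    integral_map hm₀.aemeasurable G.continuous.aestronglyMeasurable
  simp only [ContinuousMap.coe_mk, integral_complex_ofReal, hre, hre₀] at key
  simpa [Function.comp_def] using (Complex.continuous_re.tendsto _).comp key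

end Closure

/-! ### Integrals of periodic functions at small scales -/

section Covering

variable {N : ℕ} {Ω : Set (E N)}

lemma cube_ae_eq_closedCube :
    cube N =ᵐ[volume] {y : E N | ∀ i, y i ∈ Icc (-(1 / 2) : ℝ) (1 / 2)} := by
  have h := (PiLp.volume_preserving_ofLp (Fin N)).quasiMeasurePreserving.preimage_ae_eq
    (Measure.univ_pi_Ioo_ae_eq_Icc (μ := fun _ : Fin N => (volume : Measure ℝ))
      (f := fun _ => -(1 / 2)) (g := fun _ => 1 / 2))
  have h1 : cube N = WithLp.ofLp ⁻¹' (univ.pi fun _ : Fin N => Ioo (-(1 / 2) : ℝ) (1 / 2)) := by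
    ext y; simp [cube]
  have h2 : {y : E N | ∀ i, y i ∈ Icc (-(1 / 2) : ℝ) (1 / 2)} =
      WithLp.ofLp ⁻¹' Icc (fun _ : Fin N => (-(1 / 2) : ℝ)) (fun _ => 1 / 2) := by
    ext y; simp [Pi.le_def, forall_and]
  rw [h1, h2]
  exact h

/-- The integral over a fixed bounded set of a periodic function at scale `ε` is controlled by its
integral over the unit cube: the set is covered by `O(ε⁻ᴺ)` cells of volume `εᴺ`. -/
lemma exists_setLIntegral_inv_smul_le (hΩb : Bornology.IsBounded Ω) :
    ∃ C : ENNReal, C ≠ ⊤ ∧ ∀ h : E N → ENNReal,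
      (∀ᵐ y, ∀ k : Fin N → ℤ, h (y + lat k) = h y) → ∀ ε : ℝ, 0 < ε → ε ≤ 1 →
      ∫⁻ x in Ω, h (ε⁻¹ • x) ≤ C * ∫⁻ y in cube N, h y := by
  obtain ⟨R, hR0, hR⟩ := hΩb.exists_pos_norm_le
  refine ⟨ENNReal.ofReal ((2 * R + 5) ^ N), ENNReal.ofReal_ne_top, fun h hper ε hε hε1 => ?_⟩
  set Q : Set (E N) := {y | ∀ i, y i ∈ Icc (-(1 / 2) : ℝ) (1 / 2)} with hQ
  set n : ℕ := ⌈R / ε⌉₊ + 1 with hn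
  set P : Finset (Fin N → ℤ) := Fintype.piFinset fun _ => Finset.Icc (-(n : ℤ)) n with hP
  set S : P → Set (E N) := fun k => (fun y => y + lat (-(k : Fin N → ℤ))) ⁻¹' Q with hS
  have hcover : Ω ⊆ (fun x : E N => ε⁻¹ • x) ⁻¹' (⋃ k, S k) := by
    intro x hx
    have habs : ∀ i, |round ((ε⁻¹ • x) i)| ≤ (n : ℤ) := fun i => by
      have h1 : |(ε⁻¹ • x) i| ≤ R / ε := by
        refine (PiLp.norm_apply_le (ε⁻¹ • x) i).trans ?_
        rw [norm_smul, norm_inv, Real.norm_of_nonneg hε.le, inv_mul_eq_div]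
        gcongr
        exact hR x hx
      have h2 := abs_sub_round ((ε⁻¹ • x) i)
      have h3 := Nat.le_ceil (R / ε)
      have h4 : |((round ((ε⁻¹ • x) i) : ℤ) : ℝ)| ≤ ((n : ℤ) : ℝ) := by
        rw [abs_le] at h1 h2 ⊢
        rw [hn]; push_cast
        constructor <;> linarith
      exact_mod_cast h4
    refine mem_iUnion.2 ⟨⟨fun i => round ((ε⁻¹ • x) i), ?_⟩, fun i => ?_⟩
    · rw [hP, Fintype.mem_piFinset]
      intro i
      rw [Finset.mem_Icc]
      exact abs_le.1 (habs i)
    · have h2 := abs_le.1 (abs_sub_round ((ε⁻¹ • x) i))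
      simp only [PiLp.smul_apply, smul_eq_mul] at h2
      simp only [lat, PiLp.add_apply, PiLp.smul_apply, smul_eq_mul, Pi.neg_apply, Int.cast_neg]
      constructor <;> linarith
  have hSk : ∀ k : P, ∫⁻ y in S k, h y = ∫⁻ y in cube N, h y := by
    intro k
    have h1 : ∫⁻ y in S k, h y = ∫⁻ y in S k, h (y + lat (-(k : Fin N → ℤ))) := by
      refine lintegral_congr_ae ?_
      filter_upwards [ae_restrict_of_ae hper] with y hy
      rw [hy]
    rw [h1, (measurePreserving_add_right volume _).setLIntegral_comp_preimage_emb
      (measurableEmbedding_addRight _) h Q]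
    exact (setLIntegral_congr cube_ae_eq_closedCube).symm
  have hcard : (Fintype.card P : ℝ) ≤ ((2 * R + 5) / ε) ^ N := by
    have h1 : Fintype.card P = (2 * n + 1) ^ N := by
      rw [Fintype.card_coe, hP, Fintype.card_piFinset_const, Int.card_Icc]
      congr 1
      omega
    rw [h1]
    push_cast
    gcongr
    have h2 := (Nat.ceil_lt_add_one (div_nonneg hR0.le hε.le)).le
    rw [le_div_iff₀ hε, hn]
    push_cast
    have h3 : R / ε * ε = R := by field_simp
    nlinarith
  have hemb : MeasurableEmbedding fun x : E N => ε⁻¹ • x :=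
    (Homeomorph.smulOfNeZero ε⁻¹ (inv_ne_zero hε.ne')).measurableEmbedding
  calc ∫⁻ x in Ω, h (ε⁻¹ • x)
      ≤ ∫⁻ x in (fun x : E N => ε⁻¹ • x) ⁻¹' (⋃ k, S k), h (ε⁻¹ • x) := lintegral_mono_set hcover
    _ = ENNReal.ofReal (ε ^ N) * ∫⁻ y in ⋃ k, S k, h y := by
        rw [← hemb.lintegral_map (μ := volume.restrict _) h, ← hemb.restrict_map,
          Measure.map_addHaar_smul _ (inv_ne_zero hε.ne'), Measure.restrict_smul,
          lintegral_smul_measure, smul_eq_mul, finrank_euclideanSpace_fin]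
        congr 2
        rw [inv_pow, inv_inv, abs_of_pos (by positivity)]
    _ ≤ ENNReal.ofReal (ε ^ N) * ∑' k : P, ∫⁻ y in S k, h y := by
        gcongr
        exact lintegral_iUnion_le _ _
    _ = ENNReal.ofReal (ε ^ N) * ENNReal.ofReal (Fintype.card P) * ∫⁻ y in cube N, h y := by
        simp only [hSk, tsum_fintype, Finset.sum_const, Finset.card_univ, nsmul_eq_mul,
          ENNReal.ofReal_natCast, mul_assoc]
    _ ≤ ENNReal.ofReal ((2 * R + 5) ^ N) * ∫⁻ y in cube N, h y := by
        rw [← ENNReal.ofReal_mul (by positivity)]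
        gcongr
        calc ε ^ N * (Fintype.card P : ℝ) ≤ ε ^ N * ((2 * R + 5) / ε) ^ N := by gcongr
          _ = (2 * R + 5) ^ N := by rw [← mul_pow]; congr 1; field_simp

end Covering

/-! ### Integrands as functions with values in a space of continuous functions -/

/-- By the Lusin–Souslin theorem, the Borel structure of `C(K, ℝ)` is generated by the evaluations
at the points of a dense sequence. -/
lemma aestronglyMeasurable_of_eval {α K : Type*} [MeasurableSpace α] {μ : Measure α}
    [TopologicalSpace K] [CompactSpace K] [TopologicalSpace.MetrizableSpace K] {F : α → C(K, ℝ)}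
    (hF : ∀ q, AEMeasurable (fun y => F y q) μ) : AEStronglyMeasurable F μ := by
  borelize C(K, ℝ)
  rcases isEmpty_or_nonempty K with hK | hK
  · have : F = fun _ => 0 := funext fun y => ContinuousMap.ext fun q => hK.elim q
    rw [this]
    exact aestronglyMeasurable_const
  set D := TopologicalSpace.denseSeq K
  have hcont : Continuous fun (φ : C(K, ℝ)) (n : ℕ) => φ (D n) :=
    continuous_pi fun n => continuous_eval_const (D n)
  have hinj : Function.Injective fun (φ : C(K, ℝ)) (n : ℕ) => φ (D n) := fun φ ψ h =>
    DFunLike.coe_injective <| φ.continuous.ext_on (TopologicalSpace.denseRange_denseSeq K)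
      ψ.continuous (by rintro _ ⟨n, rfl⟩; exact congrFun h n)
  have hm : AEMeasurable F μ :=
    (hcont.measurableEmbedding hinj).aemeasurable_comp_iff.1
      (aemeasurable_pi_lambda _ fun n => hF (D n))
  exact hm.aestronglyMeasurable

section Slice

variable {N : ℕ} {B : ℝ → ℝ} {Ω : Set (E N)} {f : E N → E N → E N → ℝ}
  {v : E N × E N × E N → E N}

/-- For a continuous periodic `v`, the integrand `f(y, z, v(x, y, z))` becomes a bounded measurable
periodic function of `y` with values in `C(closure Ω × 𝕋, ℝ)`. -/
lemma IsIntegrand.exists_slice (hB : IsNFunction B) (hΩb : Bornology.IsBounded Ω)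
    (hf : IsIntegrand B f) (hv : IsContPer Ω v) :
    ∃ F : E N → C(closure Ω × Torus N, ℝ), AEStronglyMeasurable F volume ∧
      (∃ C, ∀ᵐ y, ∀ q, ‖F y q‖ ≤ C) ∧ (∀ᵐ y, ∀ k : Fin N → ℤ, F (y + lat k) = F y) ∧
      ∀ᵐ y, ∀ (x : closure Ω) (z : E N), F y (x, toTorus z) = f y z (v (x, y, z)) := by
  classical
  have : CompactSpace (closure Ω) := isCompact_iff_compactSpace.1 hΩb.isCompact_closure
  obtain ⟨c, hc, hreg⟩ := hf.exists_ae_regular hB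
  obtain ⟨Cv, hCv⟩ := hv.exists_bound hΩb
  have hl0 : (lat 0 : E N) = 0 := by ext i; simp [lat]
  have hvz : ∀ (x : closure Ω) (y z : E N) (h : Fin N → ℤ),
      v (x, y, z + lat h) = v (x, y, z) := fun x y z h => by
    simpa [hl0] using hv.2 x x.2 0 h y z
  have hvy : ∀ (x : closure Ω) (y z : E N) (k : Fin N → ℤ),
      v (x, y + lat k, z) = v (x, y, z) := fun x y z k => by
    simpa [hl0] using hv.2 x x.2 k 0 y z
  set G : E N → closure Ω × Torus N → ℝ :=
    fun y q => f y (fromTorus q.2) (v (q.1, y, fromTorus q.2)) with hG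
  have hvc : ∀ {T : Type} [TopologicalSpace T] {a : T → closure Ω} {b d : T → E N},
      Continuous a → Continuous b → Continuous d → Continuous fun t => v (a t, b t, d t) :=
    fun {_} _ {a _ _} ha hb hd => hv.1.comp_continuous
      ((continuous_subtype_val.comp ha).prodMk (hb.prodMk hd)) fun t => ⟨(a t).2, mem_univ _⟩
  have hGz : ∀ᵐ y, ∀ (x : closure Ω) (z : E N), G y (x, toTorus z) = f y z (v (x, y, z)) := by
    filter_upwards [hreg] with y hy x z
    obtain ⟨k, hk⟩ := exists_fromTorus_eq z
    simp only [hG, hk, hvz]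
    have := hy.2.2.2 0 k z (v (x, y, z))
    rwa [hl0, add_zero] at this
  have hGc : ∀ᵐ y, Continuous (G y) := by
    filter_upwards [hreg, hGz] with y hy hyz
    rw [← (IsOpenQuotientMap.id.prodMap isOpenQuotientMap_toTorus).continuous_comp_iff]
    have h1 : G y ∘ Prod.map id toTorus = fun q : closure Ω × E N => f y q.2 (v (q.1, y, q.2)) :=
      funext fun q => hyz q.1 q.2
    rw [h1]
    exact hy.1.comp (continuous_snd.prodMk (hvc continuous_fst continuous_const continuous_snd))
  set F : E N → C(closure Ω × Torus N, ℝ) :=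
    fun y => if h : Continuous (G y) then ⟨G y, h⟩ else 0 with hF
  have hFG : ∀ᵐ y, ∀ q, F y q = G y q := by
    filter_upwards [hGc] with y hy q
    simp [hF, hy]
  refine ⟨F, ?_, ⟨c * (1 + B Cv), ?_⟩, ?_, ?_⟩
  · obtain ⟨g, hgm, -, hg⟩ := hf.exists_measurable_version hB
    refine aestronglyMeasurable_of_eval fun q => ?_
    have hm : Measurable fun y => g y (fromTorus q.2, v (q.1, y, fromTorus q.2)) :=
      hgm.comp (measurable_id.prodMk (measurable_const.prodMk
        (hvc continuous_const continuous_id continuous_const).measurable))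
    refine hm.aemeasurable.congr ?_
    filter_upwards [hFG, hg] with y h1 h2
    rw [h1, h2]
  · filter_upwards [hFG, hreg] with y h1 h2 q
    rw [h1, Real.norm_of_nonneg (hf.nonneg _ _ _)]
    refine (h2.2.2.1 _ _).trans ?_
    gcongr
    exact hB.mono (norm_nonneg _) (hCv _ q.1.2 _ _)
  · filter_upwards [hFG, ae_forall_add_lat hFG, hreg] with y h1 h2 h3 k
    ext q
    rw [h1, h2 k]
    simp only [hG, hvy]
    have := h3.2.2.2 k 0 (fromTorus q.2) (v (q.1, y, fromTorus q.2))
    rwa [hl0, add_zero] at this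
  · filter_upwards [hFG, hGz] with y h1 h2 x z
    rw [h1, h2]

end Slice

/-! ### Convergence of the oscillating integrals -/

section Convergence

variable {N : ℕ} {B : ℝ → ℝ} {Ω : Set (E N)} {f : E N → E N → E N → ℝ}
  {v : E N × E N × E N → E N}

lemma norm_integral_sub_le_of_lintegral {α V : Type*} [MeasurableSpace α] {μ : Measure α}
    [NormedAddCommGroup V] [NormedSpace ℝ V]
    {a a' : α → V} (ha : Integrable a μ) (ha' : Integrable a' μ) {h : α → ENNReal}
    (hle : ∀ᵐ x ∂μ, ‖a x - a' x‖ₑ ≤ h x) {η : ℝ} (hη : 0 ≤ η)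
    (hh : ∫⁻ x, h x ∂μ ≤ ENNReal.ofReal η) : ‖∫ x, a x ∂μ - ∫ x, a' x ∂μ‖ ≤ η := by
  rw [← integral_sub ha ha', ← ENNReal.ofReal_le_ofReal_iff hη, ofReal_norm]
  exact (enorm_integral_le_lintegral_enorm _).trans ((lintegral_mono_ae hle).trans hh)

lemma ae_smul {p : E N → Prop} (h : ∀ᵐ y, p y) {r : ℝ} (hr : r ≠ 0) : ∀ᵐ x : E N, p (r • x) :=
  (Measure.quasiMeasurePreserving_smul volume hr).ae h

lemma IsIntegrand.integrableOn_oscillating (hB : IsNFunction B) (hΩ : IsOpen Ω)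
    (hΩb : Bornology.IsBounded Ω) (hf : IsIntegrand B f) (hv : IsContPer Ω v) {ε : ℝ}
    (hε : 0 < ε) :
    IntegrableOn (fun x => f (ε⁻¹ • x) ((ε ^ 2)⁻¹ • x)
      (v (x, ε⁻¹ • x, (ε ^ 2)⁻¹ • x))) Ω volume := by
  have : IsFiniteMeasure (volume.restrict Ω) := ⟨by simpa using hΩb.measure_lt_top⟩
  obtain ⟨c, hc, hreg⟩ := hf.exists_ae_regular hB
  obtain ⟨Cv, hCv⟩ := hv.exists_bound hΩb
  obtain ⟨g, hgm, -, hg⟩ := hf.exists_measurable_version hB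
  have hvm : AEMeasurable (fun x => v (x, ε⁻¹ • x, (ε ^ 2)⁻¹ • x)) (volume.restrict Ω) := by
    refine ContinuousOn.aemeasurable ?_ hΩ.measurableSet
    exact hv.1.comp (by fun_prop) fun x hx => ⟨subset_closure hx, mem_univ _⟩
  have hm : AEMeasurable (fun x : E N => (ε⁻¹ • x, (ε ^ 2)⁻¹ • x,
      v (x, ε⁻¹ • x, (ε ^ 2)⁻¹ • x))) (volume.restrict Ω) :=
    (measurable_const_smul _).aemeasurable.prodMk
      ((measurable_const_smul _).aemeasurable.prodMk hvm)
  refine Integrable.of_bound (C := c * (1 + B Cv)) ?_ ?_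
  · refine (hgm.comp_aemeasurable hm).aestronglyMeasurable.congr ?_
    filter_upwards [ae_restrict_of_ae (ae_smul hg (inv_ne_zero hε.ne'))] with x hx
    exact hx _ _
  · filter_upwards [ae_restrict_of_ae (ae_smul hreg (inv_ne_zero hε.ne')),
      ae_restrict_mem hΩ.measurableSet] with x hx hxΩ
    rw [Real.norm_of_nonneg (hf.nonneg _ _ _)]
    refine (hx.2.2.1 _ _).trans ?_
    gcongr
    exact hB.mono (norm_nonneg _) (hCv _ (subset_closure hxΩ) _ _)

lemma measurableEmbedding_cell :
    MeasurableEmbedding (Prod.map Subtype.val id : closure Ω × E N × E N → E N × E N × E N) :=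
  measurableEmbedding_closure.prodMap .id

lemma map_baseCellMeasure (hΩb : Bornology.IsBounded Ω) :
    (baseCellMeasure Ω).map (Prod.map Subtype.val id) = cellMeasure Ω := by
  have := isFiniteMeasure_baseMeasure hΩb
  have := isFiniteMeasure_cube (N := N)
  rw [baseCellMeasure, ← Measure.map_prod_map _ _ measurable_subtype_coe measurable_id,
    Measure.map_id, map_baseMeasure, cellMeasure_eq]

/-- The limit of the oscillating integrals. The slices `y ↦ f(y, ·, v(·, y, ·))` are approximated in
`L¹(Y; C(closure Ω × Z))` by continuous periodic functions; the error at scale `ε` is controlled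
uniformly in `ε ≤ 1` by the covering estimate. -/
lemma IsIntegrand.tendsto_oscillating (hB : IsNFunction B) (h2 : IsDelta2 B) (hΩ : IsOpen Ω)
    (hΩb : Bornology.IsBounded Ω) (hf : IsIntegrand B f) (hv : IsContPer Ω v) :
    Tendsto (fun ε : ℝ => ∫ x in Ω, f (ε⁻¹ • x) ((ε ^ 2)⁻¹ • x)
      (v (x, ε⁻¹ • x, (ε ^ 2)⁻¹ • x))) (𝓝[>] 0)
      (𝓝 (∫ p, f p.2.1 p.2.2 (v p) ∂(cellMeasure Ω))) := by
  have : CompactSpace (closure Ω) := isCompact_iff_compactSpace.1 hΩb.isCompact_closure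
  have := isFiniteMeasure_baseMeasure hΩb
  have := isFiniteMeasure_cube (N := N)
  have : IsFiniteMeasure (baseCellMeasure Ω) := by unfold baseCellMeasure; infer_instance
  obtain ⟨F, hFm, ⟨CF, hFb⟩, hFper, hFf⟩ := hf.exists_slice hB hΩb hv
  obtain ⟨C, hC, hcov⟩ := exists_setLIntegral_inv_smul_le hΩb
  have hFi : Integrable F (volume.restrict (cube N)) := by
    refine Integrable.of_bound hFm.restrict (max CF 0) ?_
    filter_upwards [ae_restrict_of_ae hFb] with y hy
    exact (ContinuousMap.norm_le _ (le_max_right _ _)).2 fun q => (hy q).trans (le_max_left _ _)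
  set K : ENNReal := C + baseMeasure Ω univ * volume.restrict (cube N) univ with hK
  have hKt : K ≠ ⊤ := ENNReal.add_ne_top.2
    ⟨hC, ENNReal.mul_ne_top (measure_ne_top _ _) (measure_ne_top _ _)⟩
  refine tendsto_of_approx fun η hη => ?_
  set η' : ENNReal := ENNReal.ofReal (η / (K.toReal + 1)) with hη'
  have hKη : K * η' ≤ ENNReal.ofReal η := by
    rw [← ENNReal.ofReal_toReal hKt, hη', ← ENNReal.ofReal_mul ENNReal.toReal_nonneg]
    refine ENNReal.ofReal_le_ofReal ?_
    have hK0 : 0 ≤ K.toReal := ENNReal.toReal_nonneg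
    rw [mul_div_assoc', div_le_iff₀ (by positivity)]
    nlinarith
  obtain ⟨F', hF'⟩ := exists_continuous_comp_approx (π := toTorus (N := N)) (s := fromTorus)
    continuous_toTorus.measurable measurable_fromTorus
    (by
      filter_upwards [ae_restrict_mem isOpen_cube.measurableSet] with y hy
      exact fromTorus_toTorus hy) hFi (ε := η') (by
      rw [Ne, hη', ENNReal.ofReal_eq_zero, not_le]; positivity)
  set h : E N → ENNReal := fun y => ‖F y - F' (toTorus y)‖ₑ with hh
  have hhm : AEMeasurable h (volume.restrict (cube N)) :=
    (hFm.restrict.sub (F'.continuous.comp continuous_toTorus).aestronglyMeasurable).enorm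
  have hhper : ∀ᵐ y, ∀ k : Fin N → ℤ, h (y + lat k) = h y := by
    filter_upwards [hFper] with y hy k
    simp only [hh, hy k, toTorus_add_lat]
  set G : C(closure Ω × Torus N × Torus N, ℝ) :=
    ⟨fun q => F' q.2.1 (q.1, q.2.2), by fun_prop⟩ with hG
  have hGi : ∀ {α : Type} [MeasurableSpace α] (μ : Measure α) [IsFiniteMeasure μ]
      (s : α → closure Ω × Torus N × Torus N), Measurable s → Integrable (fun a => G (s a)) μ :=
    fun μ _ s hs => Integrable.of_bound (G.continuous.measurable.comp hs).aestronglyMeasurable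
      ‖G‖ (ae_of_all _ fun a => G.norm_coe_le_norm _)
  have hpt : ∀ (y z : E N) (x : closure Ω),
      (∀ (x : closure Ω) (z : E N), F y (x, toTorus z) = f y z (v (x, y, z))) →
      ‖f y z (v (x, y, z)) - G (x, toTorus y, toTorus z)‖ₑ ≤ h y := by
    intro y z x hy
    rw [← hy]
    change ‖F y (x, toTorus z) - F' (toTorus y) (x, toTorus z)‖ₑ ≤ ‖F y - F' (toTorus y)‖ₑ
    rw [enorm_le_iff_norm_le]
    exact (F y - F' (toTorus y)).norm_coe_le_norm (x, toTorus z)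
  refine ⟨_, _, tendsto_integral_oscPoint hΩ hΩb G, ?_, ?_⟩
  · filter_upwards [Ioc_mem_nhdsGT (zero_lt_one (α := ℝ))] with ε hε
    rw [← integral_baseMeasure]
    refine norm_integral_sub_le_of_lintegral (h := fun x => h (ε⁻¹ • (x : E N))) ?_
      (hGi _ _ (continuous_oscPoint ε).measurable) ?_ hη.le ?_
    · have hi := hf.integrableOn_oscillating hB hΩ hΩb hv hε.1
      rw [IntegrableOn, ← map_baseMeasure, measurableEmbedding_closure.integrable_map_iff] at hi
      exact hi
    · filter_upwards [ae_baseMeasure (ae_restrict_of_ae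
        (ae_smul hFf (inv_ne_zero hε.1.ne')))] with x hx
      exact hpt _ _ x hx
    · rw [lintegral_baseMeasure (fun x => h (ε⁻¹ • x))]
      calc _ ≤ C * ∫⁻ y in cube N, h y := hcov h hhper ε hε.1 hε.2
        _ ≤ K * η' := by gcongr; exact le_self_add
        _ ≤ _ := hKη
  · rw [← map_baseCellMeasure hΩb, measurableEmbedding_cell.integral_map]
    refine norm_integral_sub_le_of_lintegral (h := fun p => h p.2.1) ?_
      (hGi _ _ continuous_cellPoint.measurable) ?_ hη.le ?_
    · have hi := (hf.memL1Per_superpos hB h2 hΩb (hv.memLBPer hB hΩ hΩb)).integrable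
      rw [← map_baseCellMeasure hΩb, measurableEmbedding_cell.integrable_map_iff] at hi
      exact hi
    · have hae : ∀ᵐ p ∂(baseCellMeasure Ω), ∀ (x : closure Ω) (z : E N),
          F p.2.1 (x, toTorus z) = f p.2.1 z (v (x, p.2.1, z)) :=
        (Measure.quasiMeasurePreserving_fst.comp Measure.quasiMeasurePreserving_snd).ae
          (ae_restrict_of_ae hFf)
      filter_upwards [hae] with p hp
      exact hpt p.2.1 p.2.2 p.1 hp
    · have h3 : ∫⁻ p, h p.2.1 ∂(baseCellMeasure Ω) =
          baseMeasure Ω univ * ((∫⁻ y in cube N, h y) * volume.restrict (cube N) univ) := by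
        have h4 := lintegral_prod_mul (μ := volume.restrict (cube N))
          (ν := volume.restrict (cube N)) hhm (g := fun _ => 1) aemeasurable_const
        have h5 := lintegral_prod_mul (μ := baseMeasure Ω)
          (ν := (volume.restrict (cube N)).prod (volume.restrict (cube N))) (f := fun _ => 1)
          (g := fun q => h q.1 * 1) aemeasurable_const
          ((hhm.comp_quasiMeasurePreserving Measure.quasiMeasurePreserving_fst).mul_const 1)
        rw [h4] at h5
        simpa [baseCellMeasure] using h5
      rw [h3]
      calc _ ≤ baseMeasure Ω univ * (η' * volume.restrict (cube N) univ) := by gcongr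
        _ = baseMeasure Ω univ * volume.restrict (cube N) univ * η' := by ring
        _ ≤ K * η' := by gcongr; exact le_add_self
        _ ≤ _ := hKη

end Convergence

end Reiterated

theorem proposition3p1 (N : ℕ) (B : ℝ → ℝ) (hB : Reiterated.IsNFunction B)
    (hB₂ : Reiterated.IsDelta2 B) (hB₂' : Reiterated.IsDelta2 (Reiterated.conj B))
    (Ω : Set (Reiterated.E N)) (hΩ : IsOpen Ω) (hΩb : Bornology.IsBounded Ω)
    (f : Reiterated.E N → Reiterated.E N → Reiterated.E N → ℝ)
    (hf : Reiterated.IsIntegrand B f) :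
    -- convergence of the oscillating integrals
    (∀ v, Reiterated.IsContPer Ω v →
      (∀ ε : ℝ, 0 < ε →
        IntegrableOn (fun x => f (ε⁻¹ • x) ((ε ^ 2)⁻¹ • x)
          (v (x, ε⁻¹ • x, (ε ^ 2)⁻¹ • x))) Ω volume) ∧
      Integrable (fun p => f p.2.1 p.2.2 (v p)) (Reiterated.cellMeasure Ω) ∧
      Tendsto (fun ε : ℝ => ∫ x in Ω, f (ε⁻¹ • x) ((ε ^ 2)⁻¹ • x)
          (v (x, ε⁻¹ • x, (ε ^ 2)⁻¹ • x)))
        (𝓝[>] 0) (𝓝 (∫ p, f p.2.1 p.2.2 (v p) ∂(Reiterated.cellMeasure Ω)))) ∧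
    -- the continuous periodic functions lie in the Orlicz space
    (∀ v, Reiterated.IsContPer Ω v → Reiterated.MemLBPer B Ω v) ∧
    -- `v ↦ f(·, ·, v)` is a continuous extension, and the only one
    Reiterated.IsContExtension B Ω f (Reiterated.superpos f) ∧
    (∀ Ψ, Reiterated.IsContExtension B Ω f Ψ → ∀ v, Reiterated.MemLBPer B Ω v →
      Ψ v =ᵐ[Reiterated.cellMeasure Ω] Reiterated.superpos f v) ∧
    -- the local Lipschitz estimate
    (∃ c > 0, ∀ v w, Reiterated.MemLBPer B Ω v → Reiterated.MemLBPer B Ω w →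
      Reiterated.MemOrlicz (Reiterated.conj B) (Reiterated.cellMeasure Ω)
        (fun p => Reiterated.density B (1 + ‖v p‖ + ‖w p‖)) ∧
      Reiterated.normL1 Ω (Reiterated.superpos f v - Reiterated.superpos f w) ≤
        c * (Reiterated.luxNorm (Reiterated.conj B) (volume.restrict Ω) (fun _ => 1) +
          Reiterated.luxNorm (Reiterated.conj B) (Reiterated.cellMeasure Ω)
            (fun p => Reiterated.density B (1 + ‖v p‖ + ‖w p‖))) *
          Reiterated.normLBPer B Ω (v - w)) := by
  refine ⟨fun v hv => ⟨fun ε hε => hf.integrableOn_oscillating hB hΩ hΩb hv hε,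
    (hf.memL1Per_superpos hB hB₂ hΩb (hv.memLBPer hB hΩ hΩb)).integrable,
    hf.tendsto_oscillating hB hB₂ hΩ hΩb hv⟩, fun v hv => hv.memLBPer hB hΩ hΩb,
    hf.isContExtension_superpos hB hB₂ hΩb, fun Ψ hΨ v hv =>
      (hf.isContExtension_superpos hB hB₂ hΩb).ae_eq hB hB₂ hΩ hΩb hΨ hv, ?_⟩
  obtain ⟨c, hc, h⟩ := hf.exists_normL1_sub_le hB hB₂ hΩb
  refine ⟨c, hc, fun v w hv hw => ⟨Reiterated.memOrlicz_density hB hB₂ hΩb hv hw,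
    (h v w hv hw).trans ?_⟩⟩
  have hn : 0 ≤ Reiterated.normLBPer B Ω (v - w) :=
    Finset.sum_nonneg fun i _ => Reiterated.luxNorm_nonneg
  gcongr
  exact le_add_of_nonneg_left Reiterated.luxNorm_nonneg
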